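/- Let $K\subset\mathbb R^2$ be a non-empty compact convex set, let $p_o(K,\theta)=\sup_{y\in K}\langle y,u_\theta\rangle$ with $u_\theta=(\cos\theta,\sin\theta)$ be its support function, and let $\mathrm{st}(K)=\frac1\pi\int_0^{2\pi}p_o(K,\theta)\,u_\theta\,d\theta$ be its Steiner point. For $x\in\mathbb R^2$ let $\mathcal F_x(K)=\bigcup_{s\in K}B_{\|s-x\|/2}\big(\tfrac12(s+x)\big)$ be the Voronoi flower of $K$ with respect to $x$, where $B_r(c)$ is the closed disc of centre $c$ and radius $r$, and let $\mathcal A$ denote area. (1) Assume that $K$ is not a single point and that $\mathrm{st}(K)$ is the origin. For every $\lambda>0$ let $\mathcal P_\lambda$ be a homogeneous Poisson point process of intensity $\lambda$ in $\mathbb R^2$, with Voronoi cells $\{y:\|y-x\|\le\|y-x'\|\text{ for all }x'\in\mathcal P_\lambda\}$, $x\in\mathcal P_\lambda$, and let $\mathscr S_\lambda$ be the event that one of these cells contains $K$. Then $\mathscr S_\lambda$ has positive probability, and almost surely on $\mathscr S_\lambda$ there is exactly one nucleus $Z_\lambda\in\mathcal P_\lambda$ whose cell contains $K$. Conditionally on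 $\mathscr S_\lambda$, the rescaled nucleus $\lambda^{1/2}Z_\lambda$ converges in distribution, as $\lambda\to\infty$, to the centered Gaussian distribution on $\mathbb R^2$ with covariance matrix $(4\pi)^{-1}I$. (2) The Steiner point is the unique minimizer of the area of the flower: $\mathcal A(\mathcal F_{\mathrm{st}(K)}(K))<\mathcal A(\mathcal F_x(K))$ for every $x\neq \mathrm{st}(K)$. -/

import Mathlib

open MeasureTheory ProbabilityTheory Filter Set
open scoped RealInnerProductSpace

noncomputable section

/-- The Euclidean plane. -/
abbrev Plane : Type := EuclideanSpace ℝ (Fin 2)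

/-- The unit vector `u_θ = (cos θ, sin θ)`. -/
def unitVec (θ : ℝ) : Plane := !₂[Real.cos θ, Real.sin θ]

/-- The support function `p_x(K, z) = sup_{y ∈ K} ⟪y - x, z⟫` of `K` with respect to `x`. -/
def supportFrom (K : Set Plane) (x z : Plane) : ℝ :=
  sSup ((fun y : Plane => ⟪y - x, z⟫) '' K)

/-- The Steiner point `st(K) = π⁻¹ ∫_0^{2π} p_o(K, u_θ) u_θ dθ`. -/
def steinerPoint (K : Set Plane) : Plane :=
  Real.pi⁻¹ • ∫ θ in (0 : ℝ)..(2 * Real.pi), supportFrom K 0 (unitVec θ) • unitVec θ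

/-- The Voronoi flower of `L` with respect to `x`: the union over `s ∈ L` of the closed discs
having the segment `[x, s]` as a diameter. -/
def voronoiFlower (x : Plane) (L : Set Plane) : Set Plane :=
  ⋃ s ∈ L, Metric.closedBall ((1 / 2 : ℝ) • (s + x)) (1 / 2 * ‖s - x‖)

/-- The Voronoi cell of the nucleus `x` in the Voronoi tessellation with set of nuclei `χ`. -/
def voronoiCell (χ : Set Plane) (x : Plane) : Set Plane :=
  {y | ∀ x' ∈ χ, ‖y - x‖ ≤ ‖y - x'‖}

/-- `x` is a nucleus of `χ` whose Voronoi cell contains `K`. -/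
def IsContainingNucleus (K χ : Set Plane) (x : Plane) : Prop :=
  x ∈ χ ∧ K ⊆ voronoiCell χ x

open Classical in
/-- The nucleus of the Voronoi cell (with respect to `χ`) that contains `K`; the value is
irrelevant (here `0`) if no cell contains `K`. -/
def containingNucleus (K χ : Set Plane) : Plane :=
  if h : ∃ x, IsContainingNucleus K χ x then h.choose else 0

/-- The event that some cell of the Voronoi tessellation generated by the random set `χ`
contains `K`. -/
def cellEvent {Ω : Type*} (K : Set Plane) (χ : Ω → Set Plane) : Set Ω :=
  {ω | ∃ x, IsContainingNucleus K (χ ω) x}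

/-- The random set `χ` is a homogeneous Poisson point process of intensity `lam` in the plane:
it is locally finite, the number of its points in a bounded Borel set `B` is a Poisson random
variable of mean `lam` times the area of `B`, and the numbers of its points in finitely many
pairwise disjoint bounded Borel sets are independent. -/
structure IsPoissonProcess {Ω : Type*} [MeasurableSpace Ω] (P : Measure Ω)
    (χ : Ω → Set Plane) (lam : ℝ) : Prop where
  finite_inter : ∀ ω, ∀ B : Set Plane, Bornology.IsBounded B → (χ ω ∩ B).Finite
  measurable_count : ∀ B : Set Plane, MeasurableSet B → Bornology.IsBounded B →
    Measurable fun ω => (χ ω ∩ B).ncard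
  law_count : ∀ B : Set Plane, MeasurableSet B → Bornology.IsBounded B →
    P.map (fun ω => (χ ω ∩ B).ncard) = poissonMeasure (lam * volume.real B).toNNReal
  indep_count : ∀ (n : ℕ) (B : Fin n → Set Plane), (∀ i, MeasurableSet (B i)) →
    (∀ i, Bornology.IsBounded (B i)) → Pairwise (fun i j => Disjoint (B i) (B j)) →
    iIndepFun (fun i ω => (χ ω ∩ B i).ncard) P

end

open scoped Topology Pointwise

/-! ### Unit vectors -/

/-! The cell of a nucleus `x` contains `K` exactly when no nucleus lies in `openFlower K x`. In
polar coordinates about `x` this region has radial function `2 * max (supportFrom K x u) 0`, hence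
area `2 * flowerIntegral K x`; `voronoiFlower x K` is half as large in every direction and has area
`flowerIntegral K x / 2`. Both claims thus reduce to one function G = `flowerIntegral K`.

Put d = x - st(K) and let p be the support function seen from st(K), so that the one seen from `x`
is p - ⟪d, u⟫. By definition of the Steiner point, p is orthogonal to all functions ⟪d, u⟫ on the
circle, so the linear term drops out (`flowerIntegral_eq`): G(x) = G(st(K)) + π‖d‖² - ∫ (⟪d, u⟫ -
p)₊². Since st(K) lies in `K` (`steinerPoint_mem`), p ≥ 0 and the last integral is at most
(π/2)‖d‖². Hence `flowerIntegral_ge`, which gives the unique minimizer.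

For the limit theorem, the nucleus has density λ exp(-2λG(x)) on the event
(`IsPoissonProcess.map_containingNucleus`). With st(K) = 0 and x = z/√λ, the quantity λ(G(x) - G(0))
tends to π‖z‖², because p > 0 for almost every direction. So the rescaled density tends to a
multiple of exp(-2π‖z‖²), while `flowerIntegral_ge` bounds it by the same multiple of exp(-π‖z‖²).
Dominated convergence for numerator and normalization finishes the proof. -/

lemma unitVec_zero (θ : ℝ) : unitVec θ 0 = Real.cos θ := rfl

lemma unitVec_one (θ : ℝ) : unitVec θ 1 = Real.sin θ := rfl

lemma plane_inner (x y : Plane) : ⟪x, y⟫ = x 0 * y 0 + x 1 * y 1 := by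
  simp [PiLp.inner_apply, Fin.sum_univ_two, mul_comm]

lemma plane_norm_sq (x : Plane) : ‖x‖ ^ 2 = x 0 ^ 2 + x 1 ^ 2 := by
  simp [EuclideanSpace.real_norm_sq_eq, Fin.sum_univ_two]

@[fun_prop]
lemma continuous_unitVec : Continuous unitVec := by
  unfold unitVec
  refine (PiLp.continuous_toLp 2 _).comp (continuous_pi fun i => ?_)
  fin_cases i
  · exact Real.continuous_cos
  · exact Real.continuous_sin

lemma norm_unitVec (θ : ℝ) : ‖unitVec θ‖ = 1 := by
  have h := plane_norm_sq (unitVec θ)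
  rw [unitVec_zero, unitVec_one, Real.cos_sq_add_sin_sq] at h
  nlinarith [norm_nonneg (unitVec θ)]

lemma unitVec_periodic : Function.Periodic unitVec (2 * Real.pi) := fun θ => by
  ext i; fin_cases i <;> simp [unitVec]

lemma unitVec_add_pi (θ : ℝ) : unitVec (θ + Real.pi) = -unitVec θ := by
  ext i; fin_cases i <;> simp [unitVec]

lemma inner_unitVec (θ φ : ℝ) : ⟪unitVec θ, unitVec φ⟫ = Real.cos (θ - φ) := by
  rw [plane_inner, Real.cos_sub]; rfl

/-- The angle 2φ + π - θ belongs to the mirror image of `unitVec θ` in the line orthogonal to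
`unitVec φ`. -/
lemma unitVec_sub_reflect (θ φ : ℝ) :
    unitVec θ - unitVec (2 * φ + Real.pi - θ) = (2 * Real.cos (θ - φ)) • unitVec φ := by
  have h1 : 2 * φ + Real.pi - θ = (φ - (θ - φ)) + Real.pi := by ring
  rw [h1, unitVec_add_pi, sub_neg_eq_add]
  set a := θ - φ with ha
  have h2 : θ = φ + a := by rw [ha]; ring
  rw [h2]
  ext i; fin_cases i
  · simp only [unitVec, Real.cos_add, Real.cos_sub]; simp; ring
  · simp only [unitVec, Real.sin_add, Real.sin_sub]; simp; ring

lemma exists_smul_unitVec (w : Plane) : ∃ φ : ℝ, w = ‖w‖ • unitVec φ := by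
  refine ⟨Complex.arg ⟨w 0, w 1⟩, ?_⟩
  have hn : ‖w‖ = ‖(⟨w 0, w 1⟩ : ℂ)‖ := by
    have h1 := plane_norm_sq w
    have h2 := Complex.sq_norm (⟨w 0, w 1⟩ : ℂ)
    rw [Complex.normSq_mk] at h2
    have : ‖w‖ ^ 2 = ‖(⟨w 0, w 1⟩ : ℂ)‖ ^ 2 := by rw [h1, h2]; ring
    exact (sq_eq_sq₀ (norm_nonneg _) (norm_nonneg _)).1 this
  rw [hn]
  ext i; fin_cases i
  · simp [unitVec]
  · simp [unitVec]

/-- The integral over one period does not depend on its position. -/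
lemma integral_period_eq {f : ℝ → ℝ} (hf : Function.Periodic f (2 * Real.pi)) (t : ℝ) :
    ∫ θ in t..t + 2 * Real.pi, f θ = ∫ θ in (0 : ℝ)..2 * Real.pi, f θ := by
  simpa using hf.intervalIntegral_add_eq t 0

lemma integral_period_shift {f : ℝ → ℝ} (hf : Function.Periodic f (2 * Real.pi)) (t : ℝ) :
    ∫ θ in (0 : ℝ)..2 * Real.pi, f (θ + t) = ∫ θ in (0 : ℝ)..2 * Real.pi, f θ := by
  rw [intervalIntegral.integral_comp_add_right, zero_add, add_comm _ t]
  exact integral_period_eq hf t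

lemma integral_period_reflect {f : ℝ → ℝ} (hf : Function.Periodic f (2 * Real.pi)) (t : ℝ) :
    ∫ θ in (0 : ℝ)..2 * Real.pi, f (t - θ) = ∫ θ in (0 : ℝ)..2 * Real.pi, f θ := by
  rw [intervalIntegral.integral_comp_sub_left]
  have := integral_period_eq hf (t - 2 * Real.pi)
  simpa using this

lemma integral_cos_sub_sq (φ : ℝ) :
    ∫ θ in (0 : ℝ)..2 * Real.pi, Real.cos (θ - φ) ^ 2 = Real.pi := by
  have hp : Function.Periodic (fun θ => Real.cos θ ^ 2) (2 * Real.pi) := fun θ => by simp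
  have := integral_period_shift hp (-φ)
  simp only [← sub_eq_add_neg] at this
  rw [this, integral_cos_sq]
  simp

lemma integral_inner_unitVec_sq (x : Plane) :
    ∫ θ in (0 : ℝ)..2 * Real.pi, ⟪x, unitVec θ⟫ ^ 2 = Real.pi * ‖x‖ ^ 2 := by
  obtain ⟨φ, hφ⟩ := exists_smul_unitVec x
  have : ∀ θ, ⟪x, unitVec θ⟫ ^ 2 = ‖x‖ ^ 2 * Real.cos (θ - φ) ^ 2 := fun θ => by
    rw [real_inner_comm]
    conv_lhs => rw [hφ]
    rw [real_inner_smul_right, inner_unitVec]; ring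
  simp_rw [this]
  rw [intervalIntegral.integral_const_mul, integral_cos_sub_sq]; ring

/-- A half-turn exchanges positive and negative parts, so each carries half of the integral of the
full square. -/
lemma integral_negPart_inner_sq (x : Plane) :
    ∫ θ in (0 : ℝ)..2 * Real.pi, (max (-⟪x, unitVec θ⟫) 0) ^ 2 = Real.pi / 2 * ‖x‖ ^ 2 := by
  have hp : Function.Periodic (fun θ => (max (-⟪x, unitVec θ⟫) 0) ^ 2) (2 * Real.pi) :=
    fun θ => by simp only [unitVec_periodic θ]
  have h1 := integral_period_shift hp Real.pi
  simp only [unitVec_add_pi, inner_neg_right, neg_neg] at h1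
  have h2 := integral_inner_unitVec_sq x
  have h3 : ∀ θ, ⟪x, unitVec θ⟫ ^ 2 =
      (max ⟪x, unitVec θ⟫ 0) ^ 2 + (max (-⟪x, unitVec θ⟫) 0) ^ 2 := fun θ => by
    rcases le_total 0 ⟪x, unitVec θ⟫ with h | h
    · rw [max_eq_left h, max_eq_right (by linarith)]; ring
    · rw [max_eq_right h, max_eq_left (by linarith)]; ring
  simp_rw [h3] at h2
  rw [intervalIntegral.integral_add (Continuous.intervalIntegrable (by fun_prop) _ _)
    (Continuous.intervalIntegrable (by fun_prop) _ _), h1] at h2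
  linarith

/-! ### The support function -/

section support

variable {K : Set Plane}

lemma bddAbove_support (hK : IsCompact K) (x z : Plane) :
    BddAbove ((fun y : Plane => ⟪y - x, z⟫) '' K) :=
  (hK.image (by fun_prop)).bddAbove

lemma inner_le_supportFrom (hK : IsCompact K) {y : Plane} (hy : y ∈ K) (x z : Plane) :
    ⟪y - x, z⟫ ≤ supportFrom K x z :=
  le_csSup (bddAbove_support hK x z) (mem_image_of_mem _ hy)

lemma exists_inner_eq_supportFrom (hK : IsCompact K) (hn : K.Nonempty) (x z : Plane) :
    ∃ y ∈ K, ⟪y - x, z⟫ = supportFrom K x z :=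
  (hK.image (f := fun y : Plane => ⟪y - x, z⟫) (by fun_prop)).sSup_mem (hn.image _)

lemma supportFrom_eq (hK : IsCompact K) (hn : K.Nonempty) (x z : Plane) :
    supportFrom K x z = supportFrom K 0 z - ⟪x, z⟫ := by
  apply le_antisymm
  · obtain ⟨y, hy, h⟩ := exists_inner_eq_supportFrom hK hn x z
    have := inner_le_supportFrom hK hy 0 z
    rw [sub_zero] at this
    rw [← h, inner_sub_left]; linarith
  · obtain ⟨y, hy, h⟩ := exists_inner_eq_supportFrom hK hn 0 z
    have := inner_le_supportFrom hK hy x z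
    rw [sub_zero] at h
    rw [inner_sub_left] at this
    rw [← h]; linarith

lemma supportFrom_add_le (hK : IsCompact K) (hn : K.Nonempty) (x z w : Plane) :
    supportFrom K x (z + w) ≤ supportFrom K x z + supportFrom K x w := by
  obtain ⟨y, hy, h⟩ := exists_inner_eq_supportFrom hK hn x (z + w)
  rw [← h, inner_add_right]
  exact add_le_add (inner_le_supportFrom hK hy x z) (inner_le_supportFrom hK hy x w)

lemma supportFrom_smul (hK : IsCompact K) (hn : K.Nonempty) (x z : Plane) {t : ℝ} (ht : 0 ≤ t) :
    supportFrom K x (t • z) = t * supportFrom K x z := by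
  apply le_antisymm
  · obtain ⟨y, hy, h⟩ := exists_inner_eq_supportFrom hK hn x (t • z)
    rw [← h, real_inner_smul_right]
    exact mul_le_mul_of_nonneg_left (inner_le_supportFrom hK hy x z) ht
  · obtain ⟨y, hy, h⟩ := exists_inner_eq_supportFrom hK hn x z
    rw [← h, ← real_inner_smul_right]
    exact inner_le_supportFrom hK hy x _

lemma continuous_supportFrom (hK : IsCompact K) (hn : K.Nonempty) (x : Plane) :
    Continuous (supportFrom K x) := by
  obtain ⟨R, hR⟩ := hK.isBounded.subset_closedBall x
  have hR' : ∀ y ∈ K, ‖y - x‖ ≤ max R 0 := fun y hy =>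
    (mem_closedBall_iff_norm.1 (hR hy)).trans (le_max_left _ _)
  refine (LipschitzWith.of_le_add_mul (Real.toNNReal R) fun z w => ?_).continuous
  obtain ⟨y, hy, h⟩ := exists_inner_eq_supportFrom hK hn x z
  have h1 := inner_le_supportFrom hK hy x w
  have h2 : ⟪y - x, z - w⟫ ≤ max R 0 * ‖z - w‖ :=
    (real_inner_le_norm _ _).trans (mul_le_mul_of_nonneg_right (hR' y hy) (norm_nonneg _))
  rw [inner_sub_right] at h2
  rw [← h, dist_eq_norm, Real.coe_toNNReal']
  linarith

lemma continuous_supportFrom_unitVec (hK : IsCompact K) (hn : K.Nonempty) (x : Plane) :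
    Continuous fun θ => supportFrom K x (unitVec θ) :=
  (continuous_supportFrom hK hn x).comp continuous_unitVec

lemma integral_supportFrom_mul_inner (hK : IsCompact K) (hn : K.Nonempty) (d : Plane) :
    ∫ θ in (0 : ℝ)..2 * Real.pi, supportFrom K 0 (unitVec θ) * ⟪d, unitVec θ⟫ =
      Real.pi * ⟪d, steinerPoint K⟫ := by
  have hc := continuous_supportFrom_unitVec hK hn 0
  have h := ContinuousLinearMap.intervalIntegral_comp_comm (μ := volume)
    (a := 0) (b := 2 * Real.pi) (innerSL ℝ d)
    (f := fun θ => supportFrom K 0 (unitVec θ) • unitVec θ)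
    (Continuous.intervalIntegrable (by fun_prop) _ _)
  simp only [innerSL_apply_apply, real_inner_smul_right] at h
  rw [h, steinerPoint, real_inner_smul_right, ← mul_assoc, mul_inv_cancel₀ Real.pi_ne_zero,
    one_mul]

/-- The reflection reverses the sign of cos(θ - φ), so θ and its mirror angle contribute equally to
the Steiner integral. The gap between the support value and the Steiner point is thereby an integral
whose integrand is pointwise nonnegative. -/
lemma inner_unitVec_steinerPoint (hK : IsCompact K) (hn : K.Nonempty) (φ : ℝ) :
    ∫ θ in (0 : ℝ)..2 * Real.pi, (2 * Real.cos (θ - φ) ^ 2 * supportFrom K 0 (unitVec φ) -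
      (supportFrom K 0 (unitVec θ) - supportFrom K 0 (unitVec (2 * φ + Real.pi - θ))) *
        Real.cos (θ - φ)) =
      2 * Real.pi * (supportFrom K 0 (unitVec φ) - ⟪unitVec φ, steinerPoint K⟫) := by
  have hc := continuous_supportFrom_unitVec hK hn 0
  have hc' : Continuous fun θ => supportFrom K 0 (unitVec (2 * φ + Real.pi - θ)) :=
    hc.comp (by fun_prop)
  set g : ℝ → ℝ := fun θ => supportFrom K 0 (unitVec θ) * Real.cos (θ - φ) with hg
  have hgc : Continuous g := by fun_prop
  have hgp : Function.Periodic g (2 * Real.pi) := fun θ => by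
    have : θ + 2 * Real.pi - φ = θ - φ + 2 * Real.pi := by ring
    simp only [hg, unitVec_periodic θ, this, Real.cos_add_two_pi]
  have h1 : ∫ θ in (0 : ℝ)..2 * Real.pi, g θ = Real.pi * ⟪unitVec φ, steinerPoint K⟫ := by
    rw [← integral_supportFrom_mul_inner hK hn]
    simp_rw [hg, ← inner_unitVec, real_inner_comm]
  have h2 := integral_period_reflect hgp (2 * φ + Real.pi)
  have h3 : ∀ θ, (2 * Real.cos (θ - φ) ^ 2 * supportFrom K 0 (unitVec φ) -
      (supportFrom K 0 (unitVec θ) - supportFrom K 0 (unitVec (2 * φ + Real.pi - θ))) *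
        Real.cos (θ - φ)) = (2 * supportFrom K 0 (unitVec φ)) * Real.cos (θ - φ) ^ 2 -
        (g θ + g (2 * φ + Real.pi - θ)) := fun θ => by
    have : Real.cos (2 * φ + Real.pi - θ - φ) = - Real.cos (θ - φ) := by
      rw [show 2 * φ + Real.pi - θ - φ = Real.pi - (θ - φ) by ring, Real.cos_pi_sub]
    simp only [hg, this]; ring
  simp_rw [h3]
  rw [intervalIntegral.integral_sub (Continuous.intervalIntegrable (by fun_prop) _ _)
    (Continuous.intervalIntegrable (by fun_prop) _ _),
    intervalIntegral.integral_add (Continuous.intervalIntegrable (by fun_prop) _ _)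
    (Continuous.intervalIntegrable (by fun_prop) _ _), h2, h1,
    intervalIntegral.integral_const_mul, integral_cos_sub_sq]
  ring

/-- A direction and its mirror image differ by a multiple of `unitVec φ`. Sublinearity of the
support function bounds the difference of their values, with the two roles exchanged according to
the sign of the cosine. -/
lemma reflect_integrand_nonneg (hK : IsCompact K) (hn : K.Nonempty) (θ φ : ℝ) :
    0 ≤ 2 * Real.cos (θ - φ) ^ 2 * supportFrom K 0 (unitVec φ) -
      (supportFrom K 0 (unitVec θ) - supportFrom K 0 (unitVec (2 * φ + Real.pi - θ))) *
        Real.cos (θ - φ) := by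
  have h := unitVec_sub_reflect θ φ
  set c := Real.cos (θ - φ)
  set u' := unitVec (2 * φ + Real.pi - θ)
  rcases le_total 0 c with hc | hc
  · have h1 := supportFrom_add_le hK hn 0 u' ((2 * c) • unitVec φ)
    rw [← h, add_sub_cancel, h, supportFrom_smul hK hn _ _ (by linarith)] at h1
    nlinarith
  · have h1 := supportFrom_add_le hK hn 0 (unitVec θ) ((-(2 * c)) • unitVec φ)
    rw [neg_smul, ← h, neg_sub, add_sub_cancel, ← neg_sub, h, ← neg_smul,
      supportFrom_smul hK hn _ _ (by linarith)] at h1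
    nlinarith

lemma inner_steinerPoint_le (hK : IsCompact K) (hn : K.Nonempty) (φ : ℝ) :
    ⟪unitVec φ, steinerPoint K⟫ ≤ supportFrom K 0 (unitVec φ) := by
  have h := inner_unitVec_steinerPoint hK hn φ
  have h1 := intervalIntegral.integral_nonneg_of_forall (μ := volume)
    (by positivity : (0 : ℝ) ≤ 2 * Real.pi) (fun θ => reflect_integrand_nonneg hK hn θ φ)
  rw [h] at h1
  by_contra hlt
  push Not at hlt
  nlinarith [Real.pi_pos]

/-- A support line through the Steiner point contains the whole set. -/
lemma supportFrom_neg_of_inner_steinerPoint_eq (hK : IsCompact K) (hn : K.Nonempty) (φ : ℝ)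
    (h0 : ⟪unitVec φ, steinerPoint K⟫ = supportFrom K 0 (unitVec φ)) :
    supportFrom K 0 (-unitVec φ) = -supportFrom K 0 (unitVec φ) := by
  have h := inner_unitVec_steinerPoint hK hn φ
  rw [h0, sub_self, mul_zero] at h
  have hc := continuous_supportFrom_unitVec hK hn 0
  have hc' : Continuous fun θ => supportFrom K 0 (unitVec (2 * φ + Real.pi - θ)) :=
    hc.comp (by fun_prop)
  set g : ℝ → ℝ := fun θ => 2 * Real.cos (θ - φ) ^ 2 * supportFrom K 0 (unitVec φ) -
      (supportFrom K 0 (unitVec θ) - supportFrom K 0 (unitVec (2 * φ + Real.pi - θ))) *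
        Real.cos (θ - φ) with hg
  have hgp : Function.Periodic g (2 * Real.pi) := fun θ => by
    have e1 : θ + 2 * Real.pi - φ = θ - φ + 2 * Real.pi := by ring
    have e2 : unitVec (2 * φ + Real.pi - (θ + 2 * Real.pi)) = unitVec (2 * φ + Real.pi - θ) := by
      rw [← sub_sub, unitVec_periodic.sub_eq]
    simp only [hg, unitVec_periodic θ, e1, e2, Real.cos_add_two_pi]
  -- The period is moved so that φ lies in the interval of integration. The integrand at φ is the
  -- width of `K` in that direction, and a continuous nonnegative integrand with zero integral must
  -- vanish there.
  rw [← integral_period_eq hgp φ] at h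
  have hgφ : g φ = supportFrom K 0 (unitVec φ) + supportFrom K 0 (-unitVec φ) := by
    have e : 2 * φ + Real.pi - φ = φ + Real.pi := by ring
    simp only [hg, sub_self, Real.cos_zero, e, unitVec_add_pi]; ring
  have hnn : 0 ≤ g φ := reflect_integrand_nonneg hK hn φ φ
  rcases hnn.eq_or_lt with h1 | h1
  · linarith
  · have := intervalIntegral.integral_pos (f := g) (a := φ) (b := φ + 2 * Real.pi)
      (by linarith [Real.pi_pos]) (by fun_prop) (fun θ _ => reflect_integrand_nonneg hK hn θ φ)
      ⟨φ, ⟨le_rfl, by linarith [Real.pi_pos]⟩, h1⟩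
    linarith

lemma steinerPoint_mem (hK : IsCompact K) (hn : K.Nonempty) (hc : Convex ℝ K) :
    steinerPoint K ∈ K := by
  by_contra hx
  obtain ⟨f, u, hf, hu⟩ := geometric_hahn_banach_closed_point hc hK.isClosed hx
  obtain ⟨w, rfl⟩ := (InnerProductSpace.toDual ℝ Plane).surjective f
  simp only [InnerProductSpace.toDual_apply_apply] at hf hu
  obtain ⟨φ, hφ⟩ := exists_smul_unitVec w
  obtain ⟨y, hy, h⟩ := exists_inner_eq_supportFrom hK hn 0 (unitVec φ)
  have h1 := inner_steinerPoint_le hK hn φ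
  have h2 := hf y hy
  rw [hφ, real_inner_smul_left] at hu h2
  rw [sub_zero, real_inner_comm] at h
  rw [← h] at h1
  nlinarith [mul_le_mul_of_nonneg_left h1 (norm_nonneg w)]

lemma supportFrom_nonneg (hK : IsCompact K) {x : Plane} (hx : x ∈ K) (z : Plane) :
    0 ≤ supportFrom K x z := by
  have := inner_le_supportFrom hK hx x z
  simpa using this

/-- If the Steiner point is the origin, the support function vanishes almost nowhere. -/
lemma ae_supportFrom_unitVec_ne_zero (hK : IsCompact K) (hnt : K.Nontrivial)
    (h0 : steinerPoint K = 0) : ∀ᵐ θ : ℝ, supportFrom K 0 (unitVec θ) ≠ 0 := by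
  have hn := hnt.nonempty
  obtain ⟨w, hw, hw0⟩ := hnt.exists_ne 0
  obtain ⟨φ, hφ⟩ := exists_smul_unitVec w
  have hsub : {θ : ℝ | supportFrom K 0 (unitVec θ) = 0} ⊆
      range fun k : ℤ => (2 * (k : ℝ) + 1) * Real.pi / 2 + φ := by
    intro θ hθ
    have hθ' : supportFrom K 0 (unitVec θ) = 0 := hθ
    -- In such a direction `K` lies on a line through 0, so the nonzero point `w` is orthogonal to
    -- `unitVec θ`. This leaves countably many angles.
    have h1 := supportFrom_neg_of_inner_steinerPoint_eq hK hn θ (by rw [h0, hθ', inner_zero_right])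
    have h2 := inner_le_supportFrom hK hw 0 (unitVec θ)
    have h3 := inner_le_supportFrom hK hw 0 (-unitVec θ)
    rw [h1, hθ', inner_neg_right, sub_zero] at h3
    rw [hθ', sub_zero] at h2
    have h4 : ⟪unitVec θ, w⟫ = 0 := by rw [real_inner_comm]; linarith
    rw [hφ, real_inner_smul_right, inner_unitVec] at h4
    rcases mul_eq_zero.1 h4 with h5 | h5
    · exact absurd (norm_eq_zero.1 h5) hw0
    · obtain ⟨k, hk⟩ := Real.cos_eq_zero_iff.1 h5
      exact ⟨k, by dsimp only; rw [← hk]; ring⟩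
  have : volume {θ : ℝ | supportFrom K 0 (unitVec θ) = 0} = 0 :=
    ((countable_range _).mono hsub).measure_zero _
  rw [ae_iff]
  simpa using this

end support

/-! ### Area in polar coordinates -/

lemma measurePreserving_prod_plane :
    MeasurePreserving (fun p : ℝ × ℝ => (!₂[p.1, p.2] : Plane)) := by
  have h := (PiLp.volume_preserving_toLp (Fin 2)).comp
    (volume_preserving_finTwoArrow ℝ).symm
  have e : (fun p : ℝ × ℝ => (!₂[p.1, p.2] : Plane)) =
      WithLp.toLp 2 ∘ (MeasurableEquiv.finTwoArrow (α := ℝ)).symm := by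
    ext p i; fin_cases i <;> rfl
  rw [e]
  exact h

lemma lintegral_polar_plane (c : Plane) {f : Plane → ENNReal} (hf : Measurable f) :
    ∫⁻ z, f z = ∫⁻ θ in Ioo (-Real.pi) Real.pi, ∫⁻ r in Ioi (0 : ℝ),
      ENNReal.ofReal r * f (c + r • unitVec θ) := by
  have hf' : Measurable fun z : Plane => f (c + z) := hf.comp (measurable_const_add c)
  rw [← lintegral_add_left_eq_self f c, ← measurePreserving_prod_plane.lintegral_comp hf',
    ← lintegral_comp_polarCoord_symm]
  have e : ∀ p : ℝ × ℝ, (!₂[(polarCoord.symm p).1, (polarCoord.symm p).2] : Plane) =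
      p.1 • unitVec p.2 := fun p => by
    ext i; fin_cases i <;> simp [unitVec, polarCoord]
  simp only [e, smul_eq_mul, polarCoord_target]
  rw [Measure.volume_eq_prod, ← Measure.prod_restrict, lintegral_prod_symm]
  have : Measurable fun p : ℝ × ℝ => c + p.1 • unitVec p.2 := by
    apply Continuous.measurable; fun_prop
  exact ((ENNReal.measurable_ofReal.comp measurable_fst).mul (hf.comp this)).aemeasurable

lemma lintegral_ofReal_Ioo (ρ : ℝ) (hρ : 0 ≤ ρ) :
    ∫⁻ r in Ioo 0 ρ, ENNReal.ofReal r = ENNReal.ofReal (ρ ^ 2 / 2) := by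
  rw [← ofReal_integral_eq_lintegral_ofReal]
  · rw [← integral_Ioc_eq_integral_Ioo, ← intervalIntegral.integral_of_le hρ, integral_id]
    simp
  · exact (continuous_id.integrableOn_Icc).mono_set Ioo_subset_Icc_self
  · filter_upwards [ae_restrict_mem measurableSet_Ioo] with r hr using hr.1.le

/-- The area of a planar set that is star-shaped with respect to `c` with radial function `ρ`
(no matter which part of its boundary belongs to it). -/
lemma volume_eq_integral_radial_sq {S : Set Plane} (hS : MeasurableSet S) (c : Plane) {ρ : ℝ → ℝ}
    (hρc : Continuous ρ) (hρ0 : ∀ θ, 0 ≤ ρ θ) (hρp : Function.Periodic ρ (2 * Real.pi))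
    (h1 : ∀ r θ, 0 < r → r < ρ θ → c + r • unitVec θ ∈ S)
    (h2 : ∀ r θ, 0 < r → c + r • unitVec θ ∈ S → r ≤ ρ θ) :
    volume S = ENNReal.ofReal (1 / 2 * ∫ θ in (0 : ℝ)..2 * Real.pi, ρ θ ^ 2) := by
  rw [← lintegral_indicator_one hS,
    lintegral_polar_plane c (measurable_one.indicator hS)]
  have inner : ∀ θ, ∫⁻ r in Ioi (0 : ℝ), ENNReal.ofReal r *
      S.indicator (1 : Plane → ENNReal) (c + r • unitVec θ) = ENNReal.ofReal (ρ θ ^ 2 / 2) := by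
    intro θ
    rw [← lintegral_ofReal_Ioo _ (hρ0 θ), ← lintegral_indicator measurableSet_Ioi,
      ← lintegral_indicator measurableSet_Ioo]
    apply lintegral_congr_ae
    have hne : ∀ᵐ r : ℝ, r ≠ ρ θ := by simp [ae_iff]
    filter_upwards [hne] with r hr
    by_cases h0 : 0 < r
    · rw [indicator_of_mem (show r ∈ Ioi (0 : ℝ) from h0)]
      by_cases hlt : r < ρ θ
      · rw [indicator_of_mem (h1 r θ h0 hlt), indicator_of_mem (show r ∈ Ioo 0 (ρ θ) from ⟨h0, hlt⟩)]
        simp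
      · rw [indicator_of_notMem (fun hm => hlt (lt_of_le_of_ne (h2 r θ h0 hm) hr)),
          indicator_of_notMem (fun hm : r ∈ Ioo 0 (ρ θ) => hlt hm.2), mul_zero]
    · rw [indicator_of_notMem (fun hm : r ∈ Ioi (0 : ℝ) => h0 hm),
        indicator_of_notMem (fun hm : r ∈ Ioo 0 (ρ θ) => h0 hm.1)]
  simp_rw [inner]
  rw [← ofReal_integral_eq_lintegral_ofReal]
  · congr 1
    have hp : Function.Periodic (fun θ => ρ θ ^ 2 / 2) (2 * Real.pi) := fun θ => by
      simp only [hρp θ]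
    have := integral_period_eq hp (-Real.pi)
    rw [← integral_Ioc_eq_integral_Ioo, ← intervalIntegral.integral_of_le
      (by linarith [Real.pi_pos]), ← intervalIntegral.integral_const_mul]
    rw [show -Real.pi + 2 * Real.pi = Real.pi by ring] at this
    rw [this]
    exact intervalIntegral.integral_congr fun θ _ => by ring
  · exact (Continuous.integrableOn_Icc (by fun_prop)).mono_set Ioo_subset_Icc_self
  · exact ae_of_all _ fun θ => by positivity

/-! ### The forbidden region of a nucleus -/

/-- The union of the open discs centred in `K` with `x` on their boundary: the cell of `x` contains
`K` if and only if no other nucleus lies in this region. -/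
def openFlower (K : Set Plane) (x : Plane) : Set Plane :=
  ⋃ y ∈ K, Metric.ball y ‖y - x‖

/-- The union of the closed discs centred in `K` with `x` on their boundary. -/
def closedFlower (K : Set Plane) (x : Plane) : Set Plane :=
  ⋃ y ∈ K, Metric.closedBall y ‖y - x‖

/-- Twice the area enclosed by the curve with radial function `max (supportFrom K x) 0`. -/
noncomputable def flowerIntegral (K : Set Plane) (x : Plane) : ℝ :=
  ∫ θ in (0 : ℝ)..2 * Real.pi, (max (supportFrom K x (unitVec θ)) 0) ^ 2

lemma isCompact_biUnion_closedBall {K : Set Plane} (hK : IsCompact K) {c : Plane → Plane}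
    {r : Plane → ℝ} (hc : Continuous c) (hr : Continuous r) (hr0 : ∀ y, 0 ≤ r y) :
    IsCompact (⋃ y ∈ K, Metric.closedBall (c y) (r y)) := by
  have : (⋃ y ∈ K, Metric.closedBall (c y) (r y)) =
      (fun p : Plane × Plane => c p.1 + r p.1 • p.2) '' (K ×ˢ Metric.closedBall 0 1) := by
    ext z
    simp only [mem_iUnion, mem_image, mem_prod, exists_prop, Prod.exists]
    constructor
    · rintro ⟨y, hy, hz⟩
      have h : z - c y ∈ r y • Metric.closedBall (0 : Plane) 1 := by
        rw [smul_unitClosedBall_of_nonneg (hr0 y), mem_closedBall_zero_iff]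
        exact mem_closedBall_iff_norm.1 hz
      obtain ⟨b, hb, e⟩ := h
      exact ⟨y, b, ⟨hy, hb⟩, by simp only [e, add_sub_cancel]⟩
    · rintro ⟨y, b, ⟨hy, hb⟩, rfl⟩
      refine ⟨y, hy, ?_⟩
      rw [mem_closedBall_iff_norm, add_sub_cancel_left, norm_smul, Real.norm_of_nonneg (hr0 y)]
      exact mul_le_of_le_one_right (hr0 y) (by simpa using hb)
  rw [this]
  exact (hK.prod (isCompact_closedBall 0 1)).image (by fun_prop)

/-! ### Flowers in polar coordinates about their base point, and their areas. -/

section area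

variable {K : Set Plane}

lemma isOpen_openFlower (K : Set Plane) (x : Plane) : IsOpen (openFlower K x) :=
  isOpen_biUnion fun _ _ => Metric.isOpen_ball

lemma isCompact_closedFlower (hK : IsCompact K) (x : Plane) : IsCompact (closedFlower K x) :=
  isCompact_biUnion_closedBall hK continuous_id (by fun_prop) fun _ => norm_nonneg _

lemma isCompact_voronoiFlower (hK : IsCompact K) (x : Plane) : IsCompact (voronoiFlower x K) :=
  isCompact_biUnion_closedBall hK (by fun_prop) (by fun_prop) fun _ => by positivity

lemma norm_sub_smul_unitVec_sq (w : Plane) (r θ : ℝ) :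
    ‖r • unitVec θ - w‖ ^ 2 = r ^ 2 - 2 * r * ⟪w, unitVec θ⟫ + ‖w‖ ^ 2 := by
  rw [norm_sub_sq_real, norm_smul, norm_unitVec, real_inner_smul_left, real_inner_comm, mul_one,
    Real.norm_eq_abs, sq_abs]
  ring

/-- A ray from `x` leaves the disc centred at `y` with `x` on its boundary at distance 2⟪y - x, u⟫,
if this is positive. Compactness makes the supremum over `K` attained. -/
lemma mem_openFlower_polar (hK : IsCompact K) (hn : K.Nonempty) (x : Plane) {r : ℝ} (θ : ℝ)
    (hr : 0 < r) :
    x + r • unitVec θ ∈ openFlower K x ↔ r < 2 * supportFrom K x (unitVec θ) := by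
  have key : ∀ y : Plane, x + r • unitVec θ ∈ Metric.ball y ‖y - x‖ ↔
      r < 2 * ⟪y - x, unitVec θ⟫ := fun y => by
    rw [mem_ball_iff_norm, ← sq_lt_sq₀ (norm_nonneg _) (norm_nonneg _),
      show x + r • unitVec θ - y = r • unitVec θ - (y - x) by abel, norm_sub_smul_unitVec_sq]
    constructor <;> intro h <;> nlinarith
  simp only [openFlower, mem_iUnion, exists_prop, key]
  constructor
  · rintro ⟨y, hy, h⟩
    linarith [inner_le_supportFrom hK hy x (unitVec θ)]
  · intro h
    obtain ⟨y, hy, he⟩ := exists_inner_eq_supportFrom hK hn x (unitVec θ)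
    exact ⟨y, hy, by rwa [he]⟩

lemma mem_closedFlower_polar (hK : IsCompact K) (hn : K.Nonempty) (x : Plane) {r : ℝ} (θ : ℝ)
    (hr : 0 < r) :
    x + r • unitVec θ ∈ closedFlower K x ↔ r ≤ 2 * supportFrom K x (unitVec θ) := by
  have key : ∀ y : Plane, x + r • unitVec θ ∈ Metric.closedBall y ‖y - x‖ ↔
      r ≤ 2 * ⟪y - x, unitVec θ⟫ := fun y => by
    rw [mem_closedBall_iff_norm, ← sq_le_sq₀ (norm_nonneg _) (norm_nonneg _),
      show x + r • unitVec θ - y = r • unitVec θ - (y - x) by abel, norm_sub_smul_unitVec_sq]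
    constructor <;> intro h <;> nlinarith
  simp only [closedFlower, mem_iUnion, exists_prop, key]
  constructor
  · rintro ⟨y, hy, h⟩
    linarith [inner_le_supportFrom hK hy x (unitVec θ)]
  · intro h
    obtain ⟨y, hy, he⟩ := exists_inner_eq_supportFrom hK hn x (unitVec θ)
    exact ⟨y, hy, by rwa [he]⟩

lemma mem_voronoiFlower_polar (hK : IsCompact K) (hn : K.Nonempty) (x : Plane) {r : ℝ} (θ : ℝ)
    (hr : 0 < r) :
    x + r • unitVec θ ∈ voronoiFlower x K ↔ r ≤ supportFrom K x (unitVec θ) := by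
  have key : ∀ y : Plane, x + r • unitVec θ ∈
      Metric.closedBall ((1 / 2 : ℝ) • (y + x)) (1 / 2 * ‖y - x‖) ↔
      r ≤ ⟪y - x, unitVec θ⟫ := fun y => by
    have e : x + r • unitVec θ - (1 / 2 : ℝ) • (y + x) =
        r • unitVec θ - (1 / 2 : ℝ) • (y - x) := by module
    rw [mem_closedBall_iff_norm, ← sq_le_sq₀ (norm_nonneg _) (by positivity), e,
      norm_sub_smul_unitVec_sq, real_inner_smul_left, norm_smul, Real.norm_of_nonneg (by norm_num)]
    constructor <;> intro h <;> nlinarith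
  simp only [voronoiFlower, mem_iUnion, exists_prop, key]
  constructor
  · rintro ⟨y, hy, h⟩
    linarith [inner_le_supportFrom hK hy x (unitVec θ)]
  · intro h
    obtain ⟨y, hy, he⟩ := exists_inner_eq_supportFrom hK hn x (unitVec θ)
    exact ⟨y, hy, by rwa [he]⟩

lemma integral_mul_max_sq (K : Set Plane) (x : Plane) (t : ℝ) :
    ∫ θ in (0 : ℝ)..2 * Real.pi, (t * max (supportFrom K x (unitVec θ)) 0) ^ 2 =
      t ^ 2 * flowerIntegral K x := by
  simp_rw [mul_pow]
  rw [intervalIntegral.integral_const_mul, flowerIntegral]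

lemma volume_openFlower (hK : IsCompact K) (hn : K.Nonempty) (x : Plane) :
    volume (openFlower K x) = ENNReal.ofReal (2 * flowerIntegral K x) := by
  have hc := continuous_supportFrom_unitVec hK hn x
  rw [volume_eq_integral_radial_sq (isOpen_openFlower K x).measurableSet x
    (ρ := fun θ => 2 * max (supportFrom K x (unitVec θ)) 0) (by fun_prop)
    (fun θ => mul_nonneg two_pos.le (le_max_right _ _)) (fun θ => by simp only [unitVec_periodic θ]),
    integral_mul_max_sq]
  · congr 1; ring
  · intro r θ hr h
    rw [mem_openFlower_polar hK hn x θ hr]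
    have h' : r / 2 < max (supportFrom K x (unitVec θ)) 0 := by linarith
    rcases lt_max_iff.1 h' with h | h <;> linarith
  · intro r θ hr h
    rw [mem_openFlower_polar hK hn x θ hr] at h
    linarith [le_max_left (supportFrom K x (unitVec θ)) 0]

lemma volume_closedFlower (hK : IsCompact K) (hn : K.Nonempty) (x : Plane) :
    volume (closedFlower K x) = ENNReal.ofReal (2 * flowerIntegral K x) := by
  have hc := continuous_supportFrom_unitVec hK hn x
  rw [volume_eq_integral_radial_sq (isCompact_closedFlower hK x).measurableSet x
    (ρ := fun θ => 2 * max (supportFrom K x (unitVec θ)) 0) (by fun_prop)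
    (fun θ => mul_nonneg two_pos.le (le_max_right _ _)) (fun θ => by simp only [unitVec_periodic θ]),
    integral_mul_max_sq]
  · congr 1; ring
  · intro r θ hr h
    rw [mem_closedFlower_polar hK hn x θ hr]
    have h' : r / 2 < max (supportFrom K x (unitVec θ)) 0 := by linarith
    rcases lt_max_iff.1 h' with h | h <;> linarith
  · intro r θ hr h
    rw [mem_closedFlower_polar hK hn x θ hr] at h
    linarith [le_max_left (supportFrom K x (unitVec θ)) 0]

lemma volume_voronoiFlower (hK : IsCompact K) (hn : K.Nonempty) (x : Plane) :
    volume (voronoiFlower x K) = ENNReal.ofReal (1 / 2 * flowerIntegral K x) := by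
  have hc := continuous_supportFrom_unitVec hK hn x
  rw [volume_eq_integral_radial_sq (isCompact_voronoiFlower hK x).measurableSet x
    (ρ := fun θ => max (supportFrom K x (unitVec θ)) 0) (by fun_prop)
    (fun θ => le_max_right _ _) (fun θ => by simp only [unitVec_periodic θ])]
  · rfl
  · intro r θ hr h
    rw [mem_voronoiFlower_polar hK hn x θ hr]
    rcases lt_max_iff.1 h with h | h <;> linarith
  · intro r θ hr h
    rw [mem_voronoiFlower_polar hK hn x θ hr] at h
    exact h.trans (le_max_left _ _)

lemma flowerIntegral_nonneg (K : Set Plane) (x : Plane) : 0 ≤ flowerIntegral K x :=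
  intervalIntegral.integral_nonneg_of_forall (by positivity) fun _ => sq_nonneg _

/-! ### Expansion of the area around the Steiner point -/

lemma supportFrom_steinerPoint_nonneg (hK : IsCompact K) (hn : K.Nonempty) (hc : Convex ℝ K)
    (z : Plane) : 0 ≤ supportFrom K (steinerPoint K) z :=
  supportFrom_nonneg hK (steinerPoint_mem hK hn hc) z

lemma integral_supportFrom_steinerPoint_mul_inner (hK : IsCompact K) (hn : K.Nonempty)
    (d : Plane) :
    ∫ θ in (0 : ℝ)..2 * Real.pi,
      supportFrom K (steinerPoint K) (unitVec θ) * ⟪d, unitVec θ⟫ = 0 := by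
  have hs := continuous_supportFrom_unitVec hK hn 0
  -- Polarization of the product ⟪st(K), u⟫⟪d, u⟫, so that only integrals of squares are needed.
  have hpol : ∀ θ, supportFrom K (steinerPoint K) (unitVec θ) * ⟪d, unitVec θ⟫ =
      supportFrom K 0 (unitVec θ) * ⟪d, unitVec θ⟫ - 1 / 4 * (⟪steinerPoint K + d, unitVec θ⟫ ^ 2 -
        ⟪steinerPoint K - d, unitVec θ⟫ ^ 2) := fun θ => by
    rw [supportFrom_eq hK hn, inner_add_left, inner_sub_left]; ring
  simp_rw [hpol]
  rw [intervalIntegral.integral_sub (Continuous.intervalIntegrable (by fun_prop) _ _)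
    (Continuous.intervalIntegrable (by fun_prop) _ _), intervalIntegral.integral_const_mul,
    intervalIntegral.integral_sub (Continuous.intervalIntegrable (by fun_prop) _ _)
    (Continuous.intervalIntegrable (by fun_prop) _ _), integral_supportFrom_mul_inner hK hn,
    integral_inner_unitVec_sq, integral_inner_unitVec_sq, norm_add_sq_real, norm_sub_sq_real,
    real_inner_comm]
  ring

lemma supportFrom_steinerPoint_sub (hK : IsCompact K) (hn : K.Nonempty) (x z : Plane) :
    supportFrom K x z = supportFrom K (steinerPoint K) z - ⟪x - steinerPoint K, z⟫ := by
  rw [supportFrom_eq hK hn x, supportFrom_eq hK hn (steinerPoint K), inner_sub_left]; ring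

lemma flowerIntegral_steinerPoint (hK : IsCompact K) (hn : K.Nonempty) (hc : Convex ℝ K) :
    flowerIntegral K (steinerPoint K) =
      ∫ θ in (0 : ℝ)..2 * Real.pi, supportFrom K (steinerPoint K) (unitVec θ) ^ 2 := by
  rw [flowerIntegral]
  exact intervalIntegral.integral_congr fun θ _ => by
    rw [max_eq_left (supportFrom_steinerPoint_nonneg hK hn hc _)]

/-- Pointwise, (p - a)₊² = (p - a)² - (a - p)₊². In the expanded square the mixed term integrates to
zero. -/
lemma flowerIntegral_eq (hK : IsCompact K) (hn : K.Nonempty) (hc : Convex ℝ K) (x : Plane) :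
    flowerIntegral K x = flowerIntegral K (steinerPoint K) +
      Real.pi * ‖x - steinerPoint K‖ ^ 2 - ∫ θ in (0 : ℝ)..2 * Real.pi,
        (max (⟪x - steinerPoint K, unitVec θ⟫ -
          supportFrom K (steinerPoint K) (unitVec θ)) 0) ^ 2 := by
  have hs := continuous_supportFrom_unitVec hK hn (steinerPoint K)
  set p := fun θ => supportFrom K (steinerPoint K) (unitVec θ) with hp
  set d := x - steinerPoint K with hd
  have e : ∀ θ, (max (supportFrom K x (unitVec θ)) 0) ^ 2 =
      p θ ^ 2 - 2 * (p θ * ⟪d, unitVec θ⟫) + ⟪d, unitVec θ⟫ ^ 2 -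
        (max (⟪d, unitVec θ⟫ - p θ) 0) ^ 2 := fun θ => by
    rw [supportFrom_steinerPoint_sub hK hn]
    change (max (p θ - ⟪d, unitVec θ⟫) 0) ^ 2 = _
    rcases le_total ⟪d, unitVec θ⟫ (p θ) with h | h
    · rw [max_eq_left (by linarith), max_eq_right (by linarith)]; ring
    · rw [max_eq_right (by linarith), max_eq_left (by linarith)]; ring
  rw [flowerIntegral_steinerPoint hK hn hc, flowerIntegral]
  simp_rw [e]
  rw [intervalIntegral.integral_sub (Continuous.intervalIntegrable (by fun_prop) _ _)
    (Continuous.intervalIntegrable (by fun_prop) _ _),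
    intervalIntegral.integral_add (Continuous.intervalIntegrable (by fun_prop) _ _)
    (Continuous.intervalIntegrable (by fun_prop) _ _),
    intervalIntegral.integral_sub (Continuous.intervalIntegrable (by fun_prop) _ _)
    (Continuous.intervalIntegrable (by fun_prop) _ _), intervalIntegral.integral_const_mul,
    integral_supportFrom_steinerPoint_mul_inner hK hn, integral_inner_unitVec_sq]
  ring

/-- As p ≥ 0, the correction term is at most the integral of the squared positive part of ⟪d, u⟫,
which uses up only half of π‖d‖². -/
lemma flowerIntegral_ge (hK : IsCompact K) (hn : K.Nonempty) (hc : Convex ℝ K) (x : Plane) :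
    flowerIntegral K (steinerPoint K) + Real.pi / 2 * ‖x - steinerPoint K‖ ^ 2 ≤
      flowerIntegral K x := by
  have hs := continuous_supportFrom_unitVec hK hn (steinerPoint K)
  have h := integral_negPart_inner_sq (-(x - steinerPoint K))
  rw [flowerIntegral_eq hK hn hc x]
  have : ∫ θ in (0 : ℝ)..2 * Real.pi, (max (⟪x - steinerPoint K, unitVec θ⟫ -
          supportFrom K (steinerPoint K) (unitVec θ)) 0) ^ 2 ≤
      ∫ θ in (0 : ℝ)..2 * Real.pi, (max (-⟪-(x - steinerPoint K), unitVec θ⟫) 0) ^ 2 := by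
    apply intervalIntegral.integral_mono_on (by positivity)
      (Continuous.intervalIntegrable (by fun_prop) _ _)
      (Continuous.intervalIntegrable (by fun_prop) _ _)
    intro θ _
    rw [inner_neg_left, neg_neg]
    have := supportFrom_steinerPoint_nonneg hK hn hc (unitVec θ)
    exact pow_le_pow_left₀ (le_max_right _ _) (max_le_max (by linarith) le_rfl) 2
  rw [h, norm_neg] at this
  linarith

theorem volume_voronoiFlower_steinerPoint_lt (hK : IsCompact K) (hn : K.Nonempty)
    (hc : Convex ℝ K) {x : Plane} (hx : x ≠ steinerPoint K) :
    volume (voronoiFlower (steinerPoint K) K) < volume (voronoiFlower x K) := by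
  rw [volume_voronoiFlower hK hn, volume_voronoiFlower hK hn]
  have h1 := flowerIntegral_ge hK hn hc x
  have h2 : 0 < ‖x - steinerPoint K‖ := norm_pos_iff.2 (sub_ne_zero.2 hx)
  have h3 := flowerIntegral_nonneg K (steinerPoint K)
  have h4 : 0 < Real.pi / 2 * ‖x - steinerPoint K‖ ^ 2 := by positivity
  exact (ENNReal.ofReal_lt_ofReal_iff (by linarith)).2 (by linarith)

/-- After scaling, the correction term is ∫ (⟪z, u⟫ - √l p)₊². Its integrand is at most ‖z‖² and
vanishes for large `l` wherever p > 0. -/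
lemma tendsto_flowerIntegral_rescaled (hK : IsCompact K) (hnt : K.Nontrivial) (hc : Convex ℝ K)
    (h0 : steinerPoint K = 0) (z : Plane) :
    Tendsto (fun l : ℝ => l * (flowerIntegral K ((√l)⁻¹ • z) - flowerIntegral K 0)) atTop
      (𝓝 (Real.pi * ‖z‖ ^ 2)) := by
  have hn := hnt.nonempty
  have hs := continuous_supportFrom_unitVec hK hn 0
  have hnn : ∀ u, 0 ≤ supportFrom K 0 u := fun u => by
    rw [← h0]; exact supportFrom_steinerPoint_nonneg hK hn hc u
  have hlim : Tendsto (fun l : ℝ => ∫ θ in (0 : ℝ)..2 * Real.pi,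
      (max (⟪z, unitVec θ⟫ - √l * supportFrom K 0 (unitVec θ)) 0) ^ 2) atTop
      (𝓝 (∫ _ in (0 : ℝ)..2 * Real.pi, 0)) := by
    refine intervalIntegral.tendsto_integral_filter_of_dominated_convergence
      (fun _ => ‖z‖ ^ 2) ?_ ?_ (Continuous.intervalIntegrable (by fun_prop) _ _) ?_
    · exact Eventually.of_forall fun l => Continuous.aestronglyMeasurable (by fun_prop)
    · refine Eventually.of_forall fun l => ae_of_all _ fun θ _ => ?_
      rw [Real.norm_of_nonneg (sq_nonneg _)]
      refine pow_le_pow_left₀ (le_max_right _ _) (max_le ?_ (norm_nonneg _)) 2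
      have h1 := real_inner_le_norm z (unitVec θ)
      rw [norm_unitVec, mul_one] at h1
      have h2 := mul_nonneg (Real.sqrt_nonneg l) (hnn (unitVec θ))
      linarith
    · filter_upwards [ae_supportFrom_unitVec_ne_zero hK hnt h0] with θ hθ _
      have hpos := lt_of_le_of_ne (hnn (unitVec θ)) hθ.symm
      have h1 : Tendsto (fun l : ℝ => √l * supportFrom K 0 (unitVec θ)) atTop atTop :=
        Real.tendsto_sqrt_atTop.atTop_mul_const hpos
      refine tendsto_const_nhds.congr' ?_
      filter_upwards [h1.eventually_ge_atTop ⟪z, unitVec θ⟫] with l hl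
      rw [max_eq_right (by linarith)]; simp
  simp only [intervalIntegral.integral_zero] at hlim
  have h2 := (tendsto_const_nhds (x := Real.pi * ‖z‖ ^ 2)).sub hlim
  rw [sub_zero] at h2
  refine h2.congr' ?_
  filter_upwards [eventually_gt_atTop 0] with l hl
  have hsl : 0 < √l := Real.sqrt_pos.2 hl
  have hsq : √l ^ 2 = l := Real.sq_sqrt hl.le
  have hE := flowerIntegral_eq hK hn hc ((√l)⁻¹ • z)
  rw [h0] at hE
  rw [hE, sub_zero, norm_smul, norm_inv, Real.norm_of_nonneg hsl.le]
  have e : ∀ θ, (max (⟪z, unitVec θ⟫ - √l * supportFrom K 0 (unitVec θ)) 0) ^ 2 =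
      l * (max (⟪(√l)⁻¹ • z, unitVec θ⟫ - supportFrom K 0 (unitVec θ)) 0) ^ 2 := fun θ => by
    have h3 : ⟪z, unitVec θ⟫ - √l * supportFrom K 0 (unitVec θ) =
        √l * (⟪(√l)⁻¹ • z, unitVec θ⟫ - supportFrom K 0 (unitVec θ)) := by
      rw [real_inner_smul_left]; field_simp
    rw [h3, ← mul_zero (√l), ← mul_max_of_nonneg _ _ hsl.le, mul_pow, hsq, mul_zero]
  simp_rw [e]
  rw [intervalIntegral.integral_const_mul]
  have : l * (Real.pi * ((√l)⁻¹ * ‖z‖) ^ 2) = Real.pi * ‖z‖ ^ 2 := by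
    rw [mul_pow, inv_pow, hsq]; field_simp
  rw [add_sub_assoc, add_sub_cancel_left, mul_sub, this]

end area

/-! ### Counts of a Poisson process -/

section counts

variable {Ω : Type*} [MeasurableSpace Ω] {P : Measure Ω} {χ : Ω → Set Plane} {lam : ℝ}

lemma IsPoissonProcess.measurableSet_ncard_eq (hχ : IsPoissonProcess P χ lam) {B : Set Plane}
    (hB : MeasurableSet B) (hb : Bornology.IsBounded B) (k : ℕ) :
    MeasurableSet {ω | (χ ω ∩ B).ncard = k} :=
  hχ.measurable_count B hB hb (measurableSet_singleton k)

lemma IsPoissonProcess.prob_ncard_eq (hχ : IsPoissonProcess P χ lam) (hlam : 0 ≤ lam)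
    {B : Set Plane} (hB : MeasurableSet B) (hb : Bornology.IsBounded B) (k : ℕ) :
    P.real {ω | (χ ω ∩ B).ncard = k} = Real.exp (-(lam * volume.real B)) *
      (lam * volume.real B) ^ k / (k.factorial : ℝ) := by
  have h := poissonMeasure_real_singleton (lam * volume.real B).toNNReal k
  rw [← hχ.law_count B hB hb, map_measureReal_apply (hχ.measurable_count B hB hb)
    (measurableSet_singleton k), Real.coe_toNNReal _ (by positivity)] at h
  exact h

lemma IsPoissonProcess.prob_inter (hχ : IsPoissonProcess P χ lam)
    {B C : Set Plane} (hB : MeasurableSet B) (hb : Bornology.IsBounded B)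
    (hC : MeasurableSet C) (hc : Bornology.IsBounded C) (hd : Disjoint B C) (s t : Set ℕ) :
    P.real ({ω | (χ ω ∩ B).ncard ∈ s} ∩ {ω | (χ ω ∩ C).ncard ∈ t}) =
      P.real {ω | (χ ω ∩ B).ncard ∈ s} * P.real {ω | (χ ω ∩ C).ncard ∈ t} := by
  have h := hχ.indep_count 2 ![B, C] (by intro i; fin_cases i <;> assumption)
    (by intro i; fin_cases i <;> assumption)
    (by
      intro i j hij
      fin_cases i <;> fin_cases j
      · exact absurd rfl hij
      · exact hd
      · exact hd.symm
      · exact absurd rfl hij)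
  have h2 := indepFun_iff_measure_inter_preimage_eq_mul.1
    (h.indepFun (show (0 : Fin 2) ≠ 1 by decide)) s t trivial trivial
  rw [measureReal_def, measureReal_def, measureReal_def, ← ENNReal.toReal_mul]
  exact congrArg ENNReal.toReal h2

variable [IsProbabilityMeasure P]

lemma IsPoissonProcess.prob_ncard_ne_zero (hχ : IsPoissonProcess P χ lam) (hlam : 0 ≤ lam)
    {B : Set Plane} (hB : MeasurableSet B) (hb : Bornology.IsBounded B) :
    P.real {ω | (χ ω ∩ B).ncard ≠ 0} = 1 - Real.exp (-(lam * volume.real B)) := by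
  have h := hχ.prob_ncard_eq hlam hB hb 0
  simp only [pow_zero, mul_one, Nat.factorial_zero, Nat.cast_one, div_one] at h
  rw [← h, ← probReal_compl_eq_one_sub (hχ.measurableSet_ncard_eq hB hb 0)]
  rfl

lemma IsPoissonProcess.prob_one_lt_ncard_le (hχ : IsPoissonProcess P χ lam) (hlam : 0 ≤ lam)
    {B : Set Plane} (hB : MeasurableSet B) (hb : Bornology.IsBounded B) :
    P.real {ω | 1 < (χ ω ∩ B).ncard} ≤ (lam * volume.real B) ^ 2 := by
  have h0 := hχ.prob_ncard_eq hlam hB hb 0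
  have h1 := hχ.prob_ncard_eq hlam hB hb 1
  simp only [pow_zero, mul_one, Nat.factorial_zero, Nat.cast_one, div_one, pow_one,
    Nat.factorial_one] at h0 h1
  have hd : Disjoint {ω | (χ ω ∩ B).ncard = 0} {ω | (χ ω ∩ B).ncard = 1} :=
    disjoint_left.2 fun ω (h : _ = 0) (h' : _ = 1) => by omega
  have he : {ω | 1 < (χ ω ∩ B).ncard} =
      ({ω | (χ ω ∩ B).ncard = 0} ∪ {ω | (χ ω ∩ B).ncard = 1})ᶜ := by
    ext ω
    simp only [mem_ofPred_eq, mem_compl_iff, mem_union]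
    omega
  rw [he, probReal_compl_eq_one_sub ((hχ.measurableSet_ncard_eq hB hb 0).union
    (hχ.measurableSet_ncard_eq hB hb 1)), measureReal_union hd
    (hχ.measurableSet_ncard_eq hB hb 1), h0, h1]
  set m := lam * volume.real B
  have hm : 0 ≤ m := by positivity
  -- The probability is 1 - exp(-m)(1 + m), and exp(-m)(1 + m) ≥ (1 - m)(1 + m) = 1 - m².
  have := Real.one_sub_le_exp_neg m
  nlinarith

lemma volume_real_ball_plane (y : Plane) {r : ℝ} (hr : 0 ≤ r) :
    volume.real (Metric.ball y r) = r ^ 2 * Real.pi := by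
  rw [measureReal_def, EuclideanSpace.volume_ball_fin_two, ENNReal.toReal_mul, ENNReal.toReal_pow,
    ENNReal.toReal_ofReal hr, ENNReal.toReal_ofReal Real.pi_pos.le]

lemma volume_real_closedBall_plane (y : Plane) {r : ℝ} (hr : 0 ≤ r) :
    volume.real (Metric.closedBall y r) = r ^ 2 * Real.pi := by
  rw [measureReal_def, EuclideanSpace.volume_closedBall_fin_two, ENNReal.toReal_mul,
    ENNReal.toReal_pow, ENNReal.toReal_ofReal hr, ENNReal.toReal_ofReal Real.pi_pos.le]

lemma volume_real_annulus (y : Plane) {r s : ℝ} (hr : 0 ≤ r) (hrs : r ≤ s) :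
    volume.real (Metric.ball y s \ Metric.ball y r) = (s ^ 2 - r ^ 2) * Real.pi := by
  rw [measureReal_sdiff (Metric.ball_subset_ball hrs) measurableSet_ball,
    volume_real_ball_plane y hr, volume_real_ball_plane y (hr.trans hrs)]
  ring

/-- Almost surely no two points of a Poisson process are at the same distance from `y`. -/
lemma IsPoissonProcess.ae_eq_of_dist_eq (hχ : IsPoissonProcess P χ lam) (hlam : 0 ≤ lam)
    (y : Plane) : ∀ᵐ ω ∂P, ∀ x ∈ χ ω, ∀ x' ∈ χ ω, dist x y = dist x' y → x = x' := by
  have key : ∀ R : ℕ, P {ω | ∃ x ∈ χ ω, ∃ x' ∈ χ ω, dist x y = dist x' y ∧ x ≠ x' ∧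
      dist x y < R} = 0 := by
    intro R
    set bad := {ω | ∃ x ∈ χ ω, ∃ x' ∈ χ ω, dist x y = dist x' y ∧ x ≠ x' ∧ dist x y < R}
    have bound : ∀ n : ℕ, P.real bad ≤ (lam * R ^ 2 * Real.pi) ^ 2 * (1 / ((n : ℝ) + 1)) := by
      intro n
      have hn : (0 : ℝ) < (n : ℝ) + 1 := by positivity
      -- These radii cut the disc of radius `R` into n + 1 rings of equal area. Two points
      -- equidistant from `y` share a ring, and each ring holds two points with probability of order
      -- 1/(n + 1)², so the union bound tends to 0.
      set ρ : ℕ → ℝ := fun k => R * √(k / ((n : ℝ) + 1)) with hρ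
      have hρ0 : ∀ k, 0 ≤ ρ k := fun k => by positivity
      have hρsq : ∀ k, ρ k ^ 2 = R ^ 2 * (k / ((n : ℝ) + 1)) := fun k => by
        rw [hρ]; dsimp only; rw [mul_pow, Real.sq_sqrt (by positivity)]
      have hρm : Monotone ρ := fun i j hij => by
        have : (i : ℝ) ≤ j := by exact_mod_cast hij
        have : (i : ℝ) / ((n : ℝ) + 1) ≤ j / ((n : ℝ) + 1) := by gcongr
        exact mul_le_mul_of_nonneg_left (Real.sqrt_le_sqrt this) (Nat.cast_nonneg R)
      have hρtop : ρ (n + 1) = R := by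
        rw [hρ]; push_cast; rw [div_self hn.ne', Real.sqrt_one, mul_one]
      set A : ℕ → Set Plane := fun k => Metric.ball y (ρ (k + 1)) \ Metric.ball y (ρ k) with hA
      have hvol : ∀ k, volume.real (A k) = R ^ 2 * Real.pi / ((n : ℝ) + 1) := fun k => by
        rw [hA]; dsimp only
        rw [volume_real_annulus y (hρ0 k) (hρm k.le_succ), hρsq, hρsq]; push_cast; field_simp
        ring
      have hAm : ∀ k, MeasurableSet (A k) := fun k => measurableSet_ball.diff measurableSet_ball
      have hAb : ∀ k, Bornology.IsBounded (A k) := fun k =>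
        Metric.isBounded_ball.subset sdiff_subset
      have hsub : bad ⊆ ⋃ k ∈ Finset.range (n + 1), {ω | 1 < (χ ω ∩ A k).ncard} := by
        rintro ω ⟨x, hx, x', hx', hd, hne, hR⟩
        have hex : ∃ k, dist x y < ρ k := ⟨n + 1, by rw [hρtop]; exact hR⟩
        classical
        have hle : Nat.find hex ≤ n + 1 := Nat.find_min' hex (by rw [hρtop]; exact hR)
        have hpos : Nat.find hex ≠ 0 := fun h => by
          have := Nat.find_spec hex
          rw [h] at this
          have h00 : ρ 0 = 0 := by simp [hρ]
          rw [h00] at this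
          exact absurd this (not_lt.2 dist_nonneg)
        obtain ⟨k, hk⟩ := Nat.exists_eq_succ_of_ne_zero hpos
        have h1 : dist x y < ρ (k + 1) := by have := Nat.find_spec hex; rwa [hk] at this
        have h2 : ¬ dist x y < ρ k := Nat.find_min hex (by omega)
        simp only [mem_iUnion, Finset.mem_range, exists_prop]
        refine ⟨k, by omega, ?_⟩
        refine (one_lt_ncard (hχ.finite_inter ω _ (hAb k))).2
          ⟨x, ⟨hx, h1, h2⟩, x', ⟨hx', ?_, ?_⟩, hne⟩
        · rw [Metric.mem_ball, ← hd]; exact h1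
        · rw [Metric.mem_ball, ← hd]; exact h2
      calc P.real bad ≤ P.real (⋃ k ∈ Finset.range (n + 1), {ω | 1 < (χ ω ∩ A k).ncard}) :=
            measureReal_mono hsub (measure_ne_top _ _)
        _ ≤ ∑ k ∈ Finset.range (n + 1), P.real {ω | 1 < (χ ω ∩ A k).ncard} :=
            measureReal_biUnion_finset_le _ _
        _ ≤ ∑ _k ∈ Finset.range (n + 1), (lam * (R ^ 2 * Real.pi / ((n : ℝ) + 1))) ^ 2 := by
            refine Finset.sum_le_sum fun k _ => ?_
            rw [← hvol k]
            exact hχ.prob_one_lt_ncard_le hlam (hAm k) (hAb k)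
        _ = (lam * R ^ 2 * Real.pi) ^ 2 * (1 / ((n : ℝ) + 1)) := by
            rw [Finset.sum_const, Finset.card_range, nsmul_eq_mul]; push_cast; field_simp
    have hlim : Tendsto (fun n : ℕ => (lam * R ^ 2 * Real.pi) ^ 2 * (1 / ((n : ℝ) + 1))) atTop
        (𝓝 0) := by
      simpa using (tendsto_one_div_add_atTop_nhds_zero_nat (𝕜 := ℝ)).const_mul
        ((lam * R ^ 2 * Real.pi) ^ 2)
    have h0 : P.real bad ≤ 0 := ge_of_tendsto' hlim bound
    exact (measureReal_eq_zero_iff).1 (le_antisymm h0 measureReal_nonneg)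
  have hnull := measure_iUnion_null key
  rw [ae_iff]
  refine measure_mono_null (fun ω hω => ?_) hnull
  simp only [mem_ofPred_eq, not_forall] at hω
  obtain ⟨x, hx, x', hx', hd, hne⟩ := hω
  obtain ⟨R, hR⟩ := exists_nat_gt (dist x y)
  exact mem_iUnion.2 ⟨R, x, hx, x', hx', hd, hne, hR⟩

end counts

/-! ### Nuclei whose cell contains a given set -/

/-- A point never lies in its own open flower, so `x` need not be removed from `χ` in the
disjointness condition. -/
lemma isContainingNucleus_iff (K χ : Set Plane) (x : Plane) :
    IsContainingNucleus K χ x ↔ x ∈ χ ∧ Disjoint χ (openFlower K x) := by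
  refine and_congr_right fun _ => ?_
  rw [disjoint_left]
  constructor
  · intro h x' hx' hm
    simp only [openFlower, mem_iUnion, exists_prop] at hm
    obtain ⟨y, hy, hm⟩ := hm
    rw [mem_ball_iff_norm'] at hm
    exact absurd (h hy x' hx') (not_le.2 hm)
  · intro h y hy x' hx'
    by_contra hlt
    refine h hx' ?_
    simp only [openFlower, mem_iUnion, exists_prop]
    exact ⟨y, hy, mem_ball_iff_norm'.2 (not_le.1 hlt)⟩

/-- The variant of `openFlower K q` with all radii increased by `r`. -/
def thickFlower (K : Set Plane) (q : Plane) (r : ℝ) : Set Plane :=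
  ⋃ y ∈ K, Metric.ball y (‖y - q‖ + r)

/-! ### Flowers squeezed between regions that do not depend on the exact nucleus. -/

section flowers

variable {K : Set Plane}

lemma mem_thickFlower {q : Plane} {r : ℝ} {z : Plane} :
    z ∈ thickFlower K q r ↔ ∃ y ∈ K, dist z y < ‖y - q‖ + r := by
  simp [thickFlower]

lemma mem_openFlower {x z : Plane} : z ∈ openFlower K x ↔ ∃ y ∈ K, dist z y < ‖y - x‖ := by
  simp [openFlower]

lemma isOpen_thickFlower (K : Set Plane) (q : Plane) (r : ℝ) : IsOpen (thickFlower K q r) :=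
  isOpen_biUnion fun _ _ => Metric.isOpen_ball

lemma isBounded_thickFlower (hK : IsCompact K) (q : Plane) (r : ℝ) :
    Bornology.IsBounded (thickFlower K q r) := by
  obtain ⟨R, hR⟩ := hK.isBounded.subset_closedBall q
  refine (Metric.isBounded_ball (x := q) (r := R + R + r)).subset fun z hz => ?_
  obtain ⟨y, hy, h⟩ := mem_thickFlower.1 hz
  have h1 := hR hy
  rw [Metric.mem_closedBall] at h1
  rw [← dist_eq_norm] at h
  rw [Metric.mem_ball]
  linarith [dist_triangle z y q]

lemma isBounded_openFlower (hK : IsCompact K) (x : Plane) :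
    Bornology.IsBounded (openFlower K x) := by
  have := isBounded_thickFlower hK x 0
  simpa [thickFlower, openFlower] using this

lemma thickFlower_mono (K : Set Plane) (q : Plane) : Monotone (thickFlower K q) :=
  fun r s hrs z hz => by
    obtain ⟨y, hy, h⟩ := mem_thickFlower.1 hz
    exact mem_thickFlower.2 ⟨y, hy, by linarith⟩

/-- With `openFlower_subset_thickFlower`, this encloses the flowers of all `x` in a small disc
between two fixed regions, to which the Poisson counts apply. -/
lemma thickFlower_neg_subset_openFlower {q x : Plane} {r : ℝ} (h : ‖x - q‖ ≤ r) :
    thickFlower K q (-r) ⊆ openFlower K x := fun z hz => by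
  obtain ⟨y, hy, hd⟩ := mem_thickFlower.1 hz
  have := norm_sub_le_norm_sub_add_norm_sub y x q
  exact mem_openFlower.2 ⟨y, hy, by linarith⟩

lemma openFlower_subset_thickFlower {q x : Plane} {r : ℝ} (h : ‖x - q‖ ≤ r) :
    openFlower K x ⊆ thickFlower K q r := fun z hz => by
  obtain ⟨y, hy, hd⟩ := mem_openFlower.1 hz
  have := norm_sub_le_norm_sub_add_norm_sub y q x
  rw [norm_sub_rev q x] at this
  exact mem_thickFlower.2 ⟨y, hy, by linarith⟩

lemma iUnion_thickFlower_neg (K : Set Plane) (x : Plane) {r : ℕ → ℝ} (hr0 : ∀ n, 0 ≤ r n)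
    (hr : Tendsto r atTop (𝓝 0)) : ⋃ n, thickFlower K x (-r n) = openFlower K x := by
  apply subset_antisymm
  · exact iUnion_subset fun n => thickFlower_neg_subset_openFlower (by simpa using hr0 n)
  · intro z hz
    obtain ⟨y, hy, hd⟩ := mem_openFlower.1 hz
    obtain ⟨n, hn⟩ := (hr.eventually_lt_const (sub_pos.2 hd)).exists
    exact mem_iUnion.2 ⟨n, mem_thickFlower.2 ⟨y, hy, by linarith⟩⟩

lemma iInter_thickFlower (hK : IsCompact K) (hn : K.Nonempty) (x : Plane) {r : ℕ → ℝ}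
    (hr0 : ∀ n, 0 < r n) (hr : Tendsto r atTop (𝓝 0)) :
    ⋂ n, thickFlower K x (r n) = closedFlower K x := by
  ext z
  simp only [mem_iInter, closedFlower, mem_iUnion, exists_prop, Metric.mem_closedBall,
    mem_thickFlower]
  constructor
  · intro h
    -- The witnesses vary with `n`; a minimizer over the compact `K` serves for all `n` at once.
    obtain ⟨y, hy, hmin⟩ := hK.exists_isMinOn hn
      (f := fun y => dist z y - ‖y - x‖) (by fun_prop)
    refine ⟨y, hy, sub_nonpos.1 (ge_of_tendsto' hr fun n => ?_)⟩
    obtain ⟨y', hy', hd⟩ := h n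
    have := hmin hy'
    simp only [mem_ofPred_eq] at this
    linarith
  · rintro ⟨y, hy, hd⟩ n
    exact ⟨y, hy, by linarith [hr0 n]⟩

lemma volume_real_openFlower (hK : IsCompact K) (hn : K.Nonempty) (x : Plane) :
    volume.real (openFlower K x) = 2 * flowerIntegral K x := by
  rw [measureReal_def, volume_openFlower hK hn, ENNReal.toReal_ofReal]
  linarith [flowerIntegral_nonneg K x]

lemma tendsto_volume_thickFlower_neg (hK : IsCompact K) (hn : K.Nonempty) (x : Plane)
    {r : ℕ → ℝ} (hr0 : ∀ n, 0 < r n) (hra : Antitone r) (hr : Tendsto r atTop (𝓝 0)) :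
    Tendsto (fun n => volume.real (thickFlower K x (-r n))) atTop
      (𝓝 (2 * flowerIntegral K x)) := by
  have h := tendsto_measure_iUnion_atTop (μ := volume)
    (s := fun n => thickFlower K x (-r n))
    (fun i j hij => thickFlower_mono K x (neg_le_neg (hra hij)))
  rw [iUnion_thickFlower_neg K x (fun n => (hr0 n).le) hr] at h
  rw [← volume_real_openFlower hK hn]
  exact (ENNReal.tendsto_toReal (isBounded_openFlower hK x).measure_lt_top.ne).comp h

/-- The outer regions shrink to the closed flower, which has the same area as the open one, so inner
and outer approximations share their limit. -/
lemma tendsto_volume_thickFlower (hK : IsCompact K) (hn : K.Nonempty) (x : Plane)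
    {r : ℕ → ℝ} (hr0 : ∀ n, 0 < r n) (hra : Antitone r) (hr : Tendsto r atTop (𝓝 0)) :
    Tendsto (fun n => volume.real (thickFlower K x (r n))) atTop
      (𝓝 (2 * flowerIntegral K x)) := by
  have h := tendsto_measure_iInter_atTop (μ := volume)
    (s := fun n => thickFlower K x (r n))
    (fun n => (isOpen_thickFlower K x _).measurableSet.nullMeasurableSet)
    (fun i j hij => thickFlower_mono K x (hra hij))
    ⟨0, (isBounded_thickFlower hK x _).measure_lt_top.ne⟩
  rw [iInter_thickFlower hK hn x hr0 hr, volume_closedFlower hK hn,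
    ← volume_openFlower hK hn] at h
  rw [← volume_real_openFlower hK hn]
  exact (ENNReal.tendsto_toReal (isBounded_openFlower hK x).measure_lt_top.ne).comp h

end flowers

/-- The event that some nucleus in `A` has a cell containing `K`. -/
def nucleusEvent {Ω : Type*} (K : Set Plane) (χ : Ω → Set Plane) (A : Set Plane) : Set Ω :=
  {ω | ∃ x ∈ A, IsContainingNucleus K (χ ω) x}

lemma cellEvent_eq_nucleusEvent_univ {Ω : Type*} (K : Set Plane) (χ : Ω → Set Plane) :
    cellEvent K χ = nucleusEvent K χ univ := by
  simp [cellEvent, nucleusEvent]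

/-! ### Measurability, almost sure uniqueness and law of the nucleus. -/

section nucleus

variable {Ω : Type*} [MeasurableSpace Ω] {P : Measure Ω} {χ : Ω → Set Plane} {lam : ℝ}
  {K : Set Plane}

lemma IsPoissonProcess.ncard_eq_zero_iff (hχ : IsPoissonProcess P χ lam) {B : Set Plane}
    (hb : Bornology.IsBounded B) (ω : Ω) : (χ ω ∩ B).ncard = 0 ↔ Disjoint (χ ω) B := by
  rw [ncard_eq_zero (hχ.finite_inter ω B hb), disjoint_iff_inter_eq_empty]

lemma IsPoissonProcess.ncard_ne_zero_iff (hχ : IsPoissonProcess P χ lam) {B : Set Plane}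
    (hb : Bornology.IsBounded B) (ω : Ω) : (χ ω ∩ B).ncard ≠ 0 ↔ ∃ x ∈ χ ω, x ∈ B := by
  rw [Ne, hχ.ncard_eq_zero_iff hb, not_disjoint_iff]

/-- Only counts in fixed sets are known to be measurable, so the event is rewritten by countably
many of them. For the converse, `A` contains finitely many points; if each had an intruder in its
flower, the intrusions would have a common positive margin, contradicting the condition at a fine
enough scale. -/
lemma IsPoissonProcess.nucleusEvent_eq_iInter (hχ : IsPoissonProcess P χ lam) (hK : IsCompact K)
    {A : Set Plane} (hb : Bornology.IsBounded A) :
    nucleusEvent K χ A = ⋂ n : ℕ, ⋃ k : ℕ,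
      {ω | (χ ω ∩ (A ∩ Metric.closedBall (TopologicalSpace.denseSeq Plane k)
        (1 / ((n : ℝ) + 1)))).ncard ≠ 0} ∩
      {ω | (χ ω ∩ thickFlower K (TopologicalSpace.denseSeq Plane k)
        (-(1 / ((n : ℝ) + 1)))).ncard = 0} := by
  ext ω
  simp only [nucleusEvent, mem_iInter, mem_iUnion, mem_inter_iff, mem_ofPred_eq,
    hχ.ncard_ne_zero_iff (hb.subset inter_subset_left),
    hχ.ncard_eq_zero_iff (isBounded_thickFlower hK _ _), isContainingNucleus_iff]
  constructor
  · rintro ⟨x, hxA, hx, hd⟩ n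
    obtain ⟨k, hk⟩ := (TopologicalSpace.denseRange_denseSeq Plane).exists_dist_lt x
      (show (0 : ℝ) < 1 / ((n : ℝ) + 1) by positivity)
    exact ⟨k, ⟨x, hx, hxA, hk.le⟩, hd.mono_right
      (thickFlower_neg_subset_openFlower (by rw [← dist_eq_norm]; exact hk.le))⟩
  · intro h
    by_contra hcon
    have hfin := hχ.finite_inter ω A hb
    -- Of the margin 2/(n + 1), one half pays for the distance from `x` to the dense point, the
    -- other for the reduced radius.
    have hev : ∀ x ∈ χ ω ∩ A, ∀ᶠ n : ℕ in atTop, ∃ x' ∈ χ ω, ∃ y ∈ K,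
        dist x' y < ‖y - x‖ - 2 * (1 / ((n : ℝ) + 1)) := by
      rintro x ⟨hx, hxA⟩
      have h1 : ¬ Disjoint (χ ω) (openFlower K x) := fun hd => hcon ⟨x, hxA, hx, hd⟩
      obtain ⟨x', hx', hm⟩ := not_disjoint_iff.1 h1
      obtain ⟨y, hy, hd⟩ := mem_openFlower.1 hm
      have hlim : Tendsto (fun n : ℕ => ‖y - x‖ - 2 * (1 / ((n : ℝ) + 1))) atTop
          (𝓝 (‖y - x‖)) := by
        simpa using ((tendsto_one_div_add_atTop_nhds_zero_nat (𝕜 := ℝ)).const_mul 2).const_sub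
          ‖y - x‖
      filter_upwards [hlim.eventually_const_lt hd] with n hn
      exact ⟨x', hx', y, hy, hn⟩
    obtain ⟨n, hn⟩ := ((eventually_all_finite hfin).2 hev).exists
    obtain ⟨k, ⟨x, hx, hxA, hxk⟩, hd⟩ := h n
    obtain ⟨x', hx', y, hy, hlt⟩ := hn x ⟨hx, hxA⟩
    refine disjoint_left.1 hd hx' (mem_thickFlower.2 ⟨y, hy, ?_⟩)
    have h1 := norm_sub_le_norm_sub_add_norm_sub y (TopologicalSpace.denseSeq Plane k) x
    rw [Metric.mem_closedBall, dist_eq_norm, norm_sub_rev] at hxk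
    linarith

lemma IsPoissonProcess.measurableSet_nucleusEvent (hχ : IsPoissonProcess P χ lam)
    (hK : IsCompact K) {A : Set Plane} (hA : MeasurableSet A) :
    MeasurableSet (nucleusEvent K χ A) := by
  have hbdd : ∀ {B : Set Plane}, MeasurableSet B → Bornology.IsBounded B →
      MeasurableSet (nucleusEvent K χ B) := by
    intro B hB hb
    rw [hχ.nucleusEvent_eq_iInter hK hb]
    refine MeasurableSet.iInter fun n => MeasurableSet.iUnion fun k => ?_
    exact (hχ.measurableSet_ncard_eq (hB.inter measurableSet_closedBall)
      (hb.subset inter_subset_left) 0).compl.inter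
      (hχ.measurableSet_ncard_eq (isOpen_thickFlower K _ _).measurableSet
        (isBounded_thickFlower hK _ _) 0)
  have : nucleusEvent K χ A = ⋃ n : ℕ, nucleusEvent K χ (A ∩ Metric.closedBall 0 n) := by
    ext ω
    simp only [nucleusEvent, mem_iUnion, mem_ofPred_eq]
    constructor
    · rintro ⟨x, hxA, hx⟩
      obtain ⟨n, hn⟩ := exists_nat_ge (dist x 0)
      exact ⟨n, x, ⟨hxA, hn⟩, hx⟩
    · rintro ⟨n, x, hxA, hx⟩
      exact ⟨x, hxA.1, hx⟩
  rw [this]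
  exact MeasurableSet.iUnion fun n => hbdd (hA.inter measurableSet_closedBall)
    (Metric.isBounded_closedBall.subset inter_subset_right)

lemma IsPoissonProcess.measurableSet_cellEvent (hχ : IsPoissonProcess P χ lam)
    (hK : IsCompact K) : MeasurableSet (cellEvent K χ) := by
  rw [cellEvent_eq_nucleusEvent_univ]
  exact hχ.measurableSet_nucleusEvent hK MeasurableSet.univ

lemma containingNucleus_spec {χ₀ : Set Plane} (h : ∃ x, IsContainingNucleus K χ₀ x) :
    IsContainingNucleus K χ₀ (containingNucleus K χ₀) := by
  rw [containingNucleus, dif_pos h]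
  exact h.choose_spec

variable [IsProbabilityMeasure P]

/-- Two nuclei whose cells both contain `K` are equidistant from any point of `K`. -/
lemma IsPoissonProcess.ae_nucleus_unique (hχ : IsPoissonProcess P χ lam) (hlam : 0 ≤ lam)
    (hn : K.Nonempty) : ∀ᵐ ω ∂P, ∀ x x', IsContainingNucleus K (χ ω) x →
      IsContainingNucleus K (χ ω) x' → x = x' := by
  obtain ⟨y, hy⟩ := hn
  filter_upwards [hχ.ae_eq_of_dist_eq hlam y] with ω hω x x' hx hx'
  refine hω x hx.1 x' hx'.1 ?_
  rw [dist_eq_norm', dist_eq_norm']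
  exact le_antisymm (hx.2 hy x' hx'.1) (hx'.2 hy x hx.1)

lemma IsPoissonProcess.containingNucleus_preimage_ae (hχ : IsPoissonProcess P χ lam)
    (hlam : 0 ≤ lam) (hn : K.Nonempty) (A : Set Plane) :
    ((fun ω => containingNucleus K (χ ω)) ⁻¹' A ∩ cellEvent K χ : Set Ω) =ᵐ[P]
      nucleusEvent K χ A := by
  refine eventuallyEq_set.2 ?_
  filter_upwards [hχ.ae_nucleus_unique hlam hn] with ω hω
  constructor
  · rintro ⟨h1, h2⟩
    exact ⟨_, h1, containingNucleus_spec h2⟩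
  · rintro ⟨x, hxA, hx⟩
    have he : ∃ x, IsContainingNucleus K (χ ω) x := ⟨x, hx⟩
    refine ⟨?_, he⟩
    rw [mem_preimage, hω _ x (containingNucleus_spec he) hx]
    exact hxA

/-- The nucleus is picked by choice. Its preimages agree with measurable events only up to null
sets, hence almost everywhere measurability. -/
lemma IsPoissonProcess.aemeasurable_containingNucleus (hχ : IsPoissonProcess P χ lam)
    (hlam : 0 ≤ lam) (hK : IsCompact K) (hn : K.Nonempty) :
    AEMeasurable (fun ω => containingNucleus K (χ ω)) (P.restrict (cellEvent K χ)) := by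
  refine NullMeasurable.aemeasurable fun A hA => ?_
  have hE := hχ.measurableSet_cellEvent hK
  have h := hχ.containingNucleus_preimage_ae hlam hn A
  refine ⟨nucleusEvent K χ A, hχ.measurableSet_nucleusEvent hK hA, ?_⟩
  refine eventuallyEq_set.2 ((ae_restrict_iff' hE).2 ?_)
  filter_upwards [eventuallyEq_set.1 h] with ω hω hωE
  rw [← hω]
  exact ⟨fun h => ⟨h, hωE⟩, fun h => h.1⟩

lemma IsPoissonProcess.map_containingNucleus_apply (hχ : IsPoissonProcess P χ lam)
    (hlam : 0 ≤ lam) (hK : IsCompact K) (hn : K.Nonempty) {A : Set Plane} (hA : MeasurableSet A) :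
    (P.restrict (cellEvent K χ)).map (fun ω => containingNucleus K (χ ω)) A =
      P (nucleusEvent K χ A) := by
  have hm := hχ.aemeasurable_containingNucleus hlam hK hn
  have hE := hχ.measurableSet_cellEvent hK
  rw [Measure.map_apply_of_aemeasurable hm hA, Measure.restrict_apply' hE]
  exact measure_congr (hχ.containingNucleus_preimage_ae hlam hn A)

/-- The event forces a point in the disc and none in the inner region outside the disc. These are
independent, and 1 - exp(-m) ≤ m. -/
lemma IsPoissonProcess.prob_nucleusEvent_closedBall_le (hχ : IsPoissonProcess P χ lam)
    (hlam : 0 ≤ lam) (hK : IsCompact K) (x : Plane) (r : ℝ) :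
    P.real (nucleusEvent K χ (Metric.closedBall x r)) ≤
      lam * volume.real (Metric.closedBall x r) *
        Real.exp (-(lam * (volume.real (thickFlower K x (-r)) -
          volume.real (Metric.closedBall x r)))) := by
  set B := Metric.closedBall x r
  set V := thickFlower K x (-r)
  have hVm : MeasurableSet V := (isOpen_thickFlower K x _).measurableSet
  have hVb : Bornology.IsBounded V := isBounded_thickFlower hK x _
  have hBm : MeasurableSet B := measurableSet_closedBall
  have hBb : Bornology.IsBounded B := Metric.isBounded_closedBall
  have hDb : Bornology.IsBounded (V \ B) := hVb.subset sdiff_subset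
  have hsub : nucleusEvent K χ B ⊆
      {ω | (χ ω ∩ B).ncard ∈ ({0}ᶜ : Set ℕ)} ∩ {ω | (χ ω ∩ (V \ B)).ncard ∈ ({0} : Set ℕ)} := by
    rintro ω ⟨z, hzB, hz⟩
    rw [isContainingNucleus_iff] at hz
    refine ⟨(hχ.ncard_ne_zero_iff hBb ω).2 ⟨z, hz.1, hzB⟩,
      (hχ.ncard_eq_zero_iff hDb ω).2 (hz.2.mono_right (sdiff_subset.trans ?_))⟩
    exact thickFlower_neg_subset_openFlower (mem_closedBall_iff_norm.1 hzB)
  refine (measureReal_mono hsub (measure_ne_top _ _)).trans ?_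
  rw [hχ.prob_inter hBm hBb (hVm.diff hBm) hDb disjoint_sdiff_right]
  have h1 := hχ.prob_ncard_ne_zero hlam hBm hBb
  have h2 := hχ.prob_ncard_eq hlam (hVm.diff hBm) hDb 0
  simp only [pow_zero, mul_one, Nat.factorial_zero, Nat.cast_one, div_one] at h2
  simp only [mem_compl_iff, mem_singleton_iff]
  rw [h1, h2]
  have h3 : volume.real V - volume.real B ≤ volume.real (V \ B) := by
    have := measureReal_mono (μ := volume) (s₁ := V) (s₂ := V \ B ∪ B)
      (fun z hz => by by_cases hzB : z ∈ B <;> simp [hz, hzB])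
      (hDb.union hBb).measure_lt_top.ne
    linarith [measureReal_union_le (μ := volume) (V \ B) B]
  have h4 := Real.one_sub_le_exp_neg (lam * volume.real B)
  exact mul_le_mul (by linarith) (Real.exp_le_exp.2 (neg_le_neg
    (mul_le_mul_of_nonneg_left h3 hlam))) (Real.exp_pos _).le (by positivity)

/-- Exactly one point in the disc and none in the outer region outside the disc suffice for the
event. -/
lemma IsPoissonProcess.le_prob_nucleusEvent_closedBall (hχ : IsPoissonProcess P χ lam)
    (hlam : 0 ≤ lam) (hK : IsCompact K) (x : Plane) (r : ℝ) :
    lam * volume.real (Metric.closedBall x r) *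
        Real.exp (-(lam * (volume.real (thickFlower K x r) +
          volume.real (Metric.closedBall x r)))) ≤
      P.real (nucleusEvent K χ (Metric.closedBall x r)) := by
  set B := Metric.closedBall x r
  set V := thickFlower K x r
  have hVm : MeasurableSet V := (isOpen_thickFlower K x _).measurableSet
  have hVb : Bornology.IsBounded V := isBounded_thickFlower hK x _
  have hBm : MeasurableSet B := measurableSet_closedBall
  have hBb : Bornology.IsBounded B := Metric.isBounded_closedBall
  have hDb : Bornology.IsBounded (V \ B) := hVb.subset sdiff_subset
  have hsub : {ω | (χ ω ∩ B).ncard ∈ ({1} : Set ℕ)} ∩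
      {ω | (χ ω ∩ (V \ B)).ncard ∈ ({0} : Set ℕ)} ⊆ nucleusEvent K χ B := by
    rintro ω ⟨h1, h2⟩
    obtain ⟨z, hz⟩ := ncard_eq_one.1 (show (χ ω ∩ B).ncard = 1 from h1)
    have h2 := (hχ.ncard_eq_zero_iff hDb ω).1 h2
    have hzm : z ∈ χ ω ∩ B := by rw [hz]; rfl
    refine ⟨z, hzm.2, (isContainingNucleus_iff _ _ _).2 ⟨hzm.1, disjoint_left.2 ?_⟩⟩
    intro w hw hwU
    have hwV := openFlower_subset_thickFlower (mem_closedBall_iff_norm.1 hzm.2) hwU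
    by_cases hwB : w ∈ B
    · have : w ∈ χ ω ∩ B := ⟨hw, hwB⟩
      rw [hz, mem_singleton_iff] at this
      rw [this] at hwU
      obtain ⟨y, -, hd⟩ := mem_openFlower.1 hwU
      rw [dist_eq_norm'] at hd
      exact lt_irrefl _ hd
    · exact disjoint_left.1 h2 hw ⟨hwV, hwB⟩
  refine le_trans ?_ (measureReal_mono hsub (measure_ne_top _ _))
  rw [hχ.prob_inter hBm hBb (hVm.diff hBm) hDb disjoint_sdiff_right]
  have h1 := hχ.prob_ncard_eq hlam hBm hBb 1
  have h2 := hχ.prob_ncard_eq hlam (hVm.diff hBm) hDb 0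
  simp only [pow_zero, mul_one, Nat.factorial_zero, Nat.cast_one, div_one, pow_one,
    Nat.factorial_one] at h1 h2
  simp only [mem_singleton_iff]
  rw [h1, h2]
  have h3 : volume.real (V \ B) ≤ volume.real V :=
    measureReal_mono sdiff_subset hVb.measure_lt_top.ne
  have h4 : lam * volume.real (V \ B) ≤ lam * volume.real V := mul_le_mul_of_nonneg_left h3 hlam
  rw [mul_comm (Real.exp (-(lam * volume.real B))), mul_assoc (lam * volume.real B),
    ← Real.exp_add]
  exact mul_le_mul_of_nonneg_left (Real.exp_le_exp.2 (by linarith)) (by positivity)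

/-- The law of the nucleus of the cell containing `K` has an explicit density. -/
theorem IsPoissonProcess.map_containingNucleus (hχ : IsPoissonProcess P χ lam)
    (hlam : 0 ≤ lam) (hK : IsCompact K) (hn : K.Nonempty) :
    (P.restrict (cellEvent K χ)).map (fun ω => containingNucleus K (χ ω)) =
      volume.withDensity fun x =>
        ENNReal.ofReal (lam * Real.exp (-(lam * (2 * flowerIntegral K x)))) := by
  set ν := (P.restrict (cellEvent K χ)).map (fun ω => containingNucleus K (χ ω)) with hν
  have hνapp : ∀ {A : Set Plane}, MeasurableSet A → ν A = P (nucleusEvent K χ A) := fun hA =>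
    hχ.map_containingNucleus_apply hlam hK hn hA
  -- Almost surely no point of the process lies in a given null set.
  have hac : ν ≪ volume := by
    refine Measure.AbsolutelyContinuous.mk fun A hA hA0 => ?_
    rw [hνapp hA]
    have hz : ∀ n : ℕ, P {ω | (χ ω ∩ (A ∩ Metric.closedBall 0 n)).ncard ≠ 0} = 0 := by
      intro n
      have hb : Bornology.IsBounded (A ∩ Metric.closedBall 0 (n : ℝ)) :=
        Metric.isBounded_closedBall.subset inter_subset_right
      have h := hχ.prob_ncard_ne_zero hlam (hA.inter measurableSet_closedBall) hb
      rw [measureReal_def volume, measure_mono_null inter_subset_left hA0] at h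
      simp only [ENNReal.toReal_zero, mul_zero, neg_zero, Real.exp_zero, sub_self] at h
      exact (measureReal_eq_zero_iff (measure_ne_top _ _)).1 h
    refine measure_mono_null (fun ω hω => ?_) (measure_iUnion_null hz)
    obtain ⟨x, hxA, hx⟩ := hω
    obtain ⟨n, hn⟩ := exists_nat_ge (dist x 0)
    exact mem_iUnion.2 ⟨n, (hχ.ncard_ne_zero_iff
      (Metric.isBounded_closedBall.subset inter_subset_right) ω).2 ⟨x, hx.1, hxA, hn⟩⟩
  rw [← Measure.withDensity_rnDeriv_eq ν volume hac]
  refine withDensity_congr_ae ?_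
  -- The density is almost everywhere the limit of ν(disc)/area(disc). The two disc estimates
  -- squeeze this ratio, since the disc area vanishes and both thick flowers tend to the flower in
  -- area.
  filter_upwards [Besicovitch.ae_tendsto_rnDeriv ν volume] with x hx
  set r : ℕ → ℝ := fun n => 1 / ((n : ℝ) + 1) with hr
  have hr0 : ∀ n, 0 < r n := fun n => by positivity
  have hra : Antitone r := fun i j hij => by
    have : (i : ℝ) ≤ j := by exact_mod_cast hij
    exact one_div_le_one_div_of_le (by positivity) (by linarith)
  have hrt : Tendsto r atTop (𝓝 0) := tendsto_one_div_add_atTop_nhds_zero_nat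
  have hrw : Tendsto r atTop (𝓝[>] 0) :=
    tendsto_nhdsWithin_iff.2 ⟨hrt, Eventually.of_forall hr0⟩
  refine tendsto_nhds_unique (hx.comp hrw) ?_
  set b : ℕ → ℝ := fun n => volume.real (Metric.closedBall x (r n)) with hbdef
  have hbval : ∀ n, b n = r n ^ 2 * Real.pi := fun n =>
    volume_real_closedBall_plane x (hr0 n).le
  have hb0 : ∀ n, 0 < b n := fun n => by
    rw [hbval]; have := hr0 n; positivity
  have hbt : Tendsto b atTop (𝓝 0) := by
    simp_rw [funext hbval]
    simpa using (hrt.pow 2).mul_const Real.pi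
  set p : ℕ → ℝ := fun n => P.real (nucleusEvent K χ (Metric.closedBall x (r n)))
  have hlow := tendsto_volume_thickFlower hK hn x hr0 hra hrt
  have hupp := tendsto_volume_thickFlower_neg hK hn x hr0 hra hrt
  have hlim : Tendsto (fun n => p n / b n) atTop
      (𝓝 (lam * Real.exp (-(lam * (2 * flowerIntegral K x))))) := by
    have hcont : Continuous fun t : ℝ => lam * Real.exp (-(lam * t)) := by fun_prop
    have h1 := (hcont.tendsto _).comp (hlow.add hbt)
    have h2 := (hcont.tendsto _).comp (hupp.sub hbt)
    simp only [add_zero, sub_zero] at h1 h2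
    refine tendsto_of_tendsto_of_tendsto_of_le_of_le h1 h2 (fun n => ?_) (fun n => ?_)
    · have := hχ.le_prob_nucleusEvent_closedBall hlam hK x (r n)
      dsimp only [Function.comp_apply]
      rw [le_div_iff₀ (hb0 n), mul_right_comm]
      exact this
    · have := hχ.prob_nucleusEvent_closedBall_le hlam hK x (r n)
      dsimp only [Function.comp_apply]
      rw [div_le_iff₀ (hb0 n), mul_right_comm]
      exact this
  refine (ENNReal.tendsto_ofReal hlim).congr fun n => ?_
  dsimp only [Function.comp_apply]
  rw [hνapp measurableSet_closedBall, ENNReal.ofReal_div_of_pos (hb0 n), ofReal_measureReal,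
    ofReal_measureReal Metric.isBounded_closedBall.measure_lt_top.ne]

end nucleus

/-! ### The Gaussian limit -/

lemma integrable_exp_neg_mul_norm_sq {b : ℝ} (hb : 0 < b) :
    Integrable fun z : Plane => Real.exp (-(b * ‖z‖ ^ 2)) := by
  refine Integrable.of_integral_ne_zero ?_
  have h := GaussianFourier.integral_rexp_neg_mul_sq_norm (V := Plane) hb
  simp_rw [neg_mul] at h
  rw [h]
  have := Real.pi_pos
  positivity

lemma integral_exp_neg_mul_norm_sq {b : ℝ} (hb : 0 < b) :
    ∫ z : Plane, Real.exp (-(b * ‖z‖ ^ 2)) = Real.pi / b := by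
  have h := GaussianFourier.integral_rexp_neg_mul_sq_norm (V := Plane) hb
  simp_rw [neg_mul] at h
  rw [h]
  simp

/-- Both sides are finite measures with the same characteristic function. Variance 1/(4π) gives the
exponent -2π‖z‖², whose integral 1/2 explains the factor 2. -/
lemma multivariateGaussian_eq_withDensity :
    multivariateGaussian (0 : Plane) ((4 * Real.pi)⁻¹ • (1 : Matrix (Fin 2) (Fin 2) ℝ)) =
      volume.withDensity fun z =>
        ENNReal.ofReal (2 * Real.exp (-(2 * Real.pi * ‖z‖ ^ 2))) := by
  have hint : Integrable fun z : Plane => 2 * Real.exp (-(2 * Real.pi * ‖z‖ ^ 2)) :=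
    (integrable_exp_neg_mul_norm_sq (by positivity)).const_mul 2
  have hfin : IsFiniteMeasure (volume.withDensity fun z : Plane =>
      ENNReal.ofReal (2 * Real.exp (-(2 * Real.pi * ‖z‖ ^ 2)))) :=
    isFiniteMeasure_withDensity_ofReal hint.2
  refine Measure.ext_of_charFun ?_
  ext t
  have hS : ((4 * Real.pi)⁻¹ • (1 : Matrix (Fin 2) (Fin 2) ℝ)).PosSemidef :=
    Matrix.PosSemidef.one.smul (by positivity)
  rw [charFun_multivariateGaussian hS, charFun_apply,
    integral_withDensity_eq_integral_toReal_smul (by fun_prop)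
      (ae_of_all _ fun _ => ENNReal.ofReal_lt_top)]
  have h := GaussianFourier.integral_cexp_neg_mul_sq_norm_add (V := Plane)
    (b := ((2 * Real.pi : ℝ) : ℂ)) (by rw [Complex.ofReal_re]; positivity) Complex.I t
  have e : ∀ z : Plane, (ENNReal.ofReal (2 * Real.exp (-(2 * Real.pi * ‖z‖ ^ 2)))).toReal •
      Complex.exp (⟪z, t⟫ * Complex.I) =
      2 * Complex.exp (-((2 * Real.pi : ℝ) : ℂ) * ‖z‖ ^ 2 + Complex.I * ⟪t, z⟫) := fun z => by
    rw [ENNReal.toReal_ofReal (by positivity), Complex.exp_add, Complex.real_smul,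
      real_inner_comm t z]
    push_cast
    rw [mul_comm Complex.I, neg_mul, mul_assoc]
  simp_rw [e]
  rw [integral_const_mul, h]
  have hpi : (Real.pi : ℂ) ≠ 0 := by exact_mod_cast Real.pi_ne_zero
  have hhalf : (Real.pi : ℂ) / ((2 * Real.pi : ℝ) : ℂ) = 2⁻¹ := by
    push_cast; field_simp
  have hquad : t.ofLp ⬝ᵥ ((4 * Real.pi)⁻¹ • (1 : Matrix (Fin 2) (Fin 2) ℝ)).mulVec t.ofLp =
      (4 * Real.pi)⁻¹ * ‖t‖ ^ 2 := by
    rw [Matrix.smul_mulVec, Matrix.one_mulVec, plane_norm_sq]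
    simp [dotProduct, Fin.sum_univ_two]; ring
  rw [hhalf, hquad, finrank_euclideanSpace_fin, Nat.cast_ofNat, div_self two_ne_zero,
    Complex.cpow_one, ← mul_assoc, mul_inv_cancel₀ two_ne_zero, one_mul, inner_zero_right]
  congr 1
  rw [Complex.I_sq]
  push_cast
  field_simp
  ring

section limit

variable {K : Set Plane}

lemma continuous_flowerIntegral (hK : IsCompact K) (hn : K.Nonempty) :
    Continuous (flowerIntegral K) := by
  have e : flowerIntegral K = fun x => ∫ θ in (0 : ℝ)..2 * Real.pi,
      (max (supportFrom K 0 (unitVec θ) - ⟪x, unitVec θ⟫) 0) ^ 2 := by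
    funext x
    simp only [flowerIntegral, supportFrom_eq hK hn x]
  rw [e]
  have := continuous_supportFrom_unitVec hK hn 0
  refine intervalIntegral.continuous_parametric_intervalIntegral_of_continuous' ?_ _ _
  have h : Continuous fun p : Plane × ℝ => supportFrom K 0 (unitVec p.2) :=
    this.comp continuous_snd
  unfold Function.uncurry
  fun_prop

/-- The density of the rescaled nucleus, up to a factor not depending on `z`. -/
noncomputable def rescaledWeight (K : Set Plane) (l : ℝ) (z : Plane) : ℝ :=
  Real.exp (-(l * (2 * (flowerIntegral K ((√l)⁻¹ • z) - flowerIntegral K 0))))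

lemma continuous_rescaledWeight (hK : IsCompact K) (hn : K.Nonempty) (l : ℝ) :
    Continuous (rescaledWeight K l) := by
  have := continuous_flowerIntegral hK hn
  unfold rescaledWeight
  fun_prop

lemma rescaledWeight_le (hK : IsCompact K) (hn : K.Nonempty) (hc : Convex ℝ K)
    (h0 : steinerPoint K = 0) {l : ℝ} (hl : 0 < l) (z : Plane) :
    rescaledWeight K l z ≤ Real.exp (-(Real.pi * ‖z‖ ^ 2)) := by
  have h := flowerIntegral_ge hK hn hc ((√l)⁻¹ • z)
  rw [h0, sub_zero, norm_smul, norm_inv, Real.norm_of_nonneg (Real.sqrt_nonneg l), mul_pow,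
    inv_pow, Real.sq_sqrt hl.le] at h
  refine Real.exp_le_exp.2 (neg_le_neg ?_)
  calc Real.pi * ‖z‖ ^ 2 = l * (2 * (Real.pi / 2 * (l⁻¹ * ‖z‖ ^ 2))) := by field_simp
    _ ≤ _ := mul_le_mul_of_nonneg_left (by linarith) hl.le

lemma integrable_rescaledWeight (hK : IsCompact K) (hn : K.Nonempty) (hc : Convex ℝ K)
    (h0 : steinerPoint K = 0) {l : ℝ} (hl : 0 < l) : Integrable (rescaledWeight K l) := by
  refine (integrable_exp_neg_mul_norm_sq Real.pi_pos).mono'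
    (continuous_rescaledWeight hK hn l).aestronglyMeasurable (ae_of_all _ fun z => ?_)
  rw [Real.norm_of_nonneg (show 0 ≤ rescaledWeight K l z from (Real.exp_pos _).le)]
  exact rescaledWeight_le hK hn hc h0 hl z

lemma tendsto_integral_rescaledWeight (hK : IsCompact K) (hnt : K.Nontrivial) (hc : Convex ℝ K)
    (h0 : steinerPoint K = 0) (f : BoundedContinuousFunction Plane ℝ) :
    Tendsto (fun l : ℝ => ∫ z, f z * rescaledWeight K l z) atTop
      (𝓝 (∫ z, f z * Real.exp (-(2 * Real.pi * ‖z‖ ^ 2)))) := by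
  refine tendsto_integral_filter_of_dominated_convergence
    (fun z => ‖f‖ * Real.exp (-(Real.pi * ‖z‖ ^ 2))) ?_ ?_
    ((integrable_exp_neg_mul_norm_sq Real.pi_pos).const_mul _) ?_
  · exact Eventually.of_forall fun l =>
      (f.continuous.mul (continuous_rescaledWeight hK hnt.nonempty l)).aestronglyMeasurable
  · filter_upwards [eventually_gt_atTop 0] with l hl
    refine ae_of_all _ fun z => ?_
    rw [norm_mul, Real.norm_of_nonneg (show 0 ≤ rescaledWeight K l z from (Real.exp_pos _).le)]
    exact mul_le_mul (f.norm_coe_le_norm z) (rescaledWeight_le hK hnt.nonempty hc h0 hl z)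
      (Real.exp_pos _).le (norm_nonneg _)
  · refine ae_of_all _ fun z => Tendsto.const_mul _ ?_
    have h := (tendsto_flowerIntegral_rescaled hK hnt hc h0 z).const_mul (-2)
    rw [show -(2 * Real.pi * ‖z‖ ^ 2) = -2 * (Real.pi * ‖z‖ ^ 2) by ring]
    refine (Real.continuous_exp.tendsto _).comp (h.congr fun l => ?_)
    ring

end limit

/-! ### Conditional law of the rescaled nucleus. -/

section conditional

variable {Ω : Type*} [MeasurableSpace Ω] {P : Measure Ω} [IsProbabilityMeasure P]
  {χ : Ω → Set Plane} {l : ℝ} {K : Set Plane}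

/-- In the plane the substitution z = √l x has Jacobian `l`, which absorbs the factor `l` of the
density. The exponential prefactor will cancel on conditioning. -/
lemma IsPoissonProcess.setIntegral_rescaled (hχ : IsPoissonProcess P χ l) (hl : 0 < l)
    (hK : IsCompact K) (hn : K.Nonempty) {f : Plane → ℝ} (hf : Continuous f) :
    ∫ ω in cellEvent K χ, f (√l • containingNucleus K (χ ω)) ∂P =
      Real.exp (-(l * (2 * flowerIntegral K 0))) * ∫ z, f z * rescaledWeight K l z := by
  have hG := continuous_flowerIntegral hK hn
  have hm := hχ.aemeasurable_containingNucleus hl.le hK hn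
  have hsl : 0 < √l := Real.sqrt_pos.2 hl
  have h1 := integral_map hm (f := fun x : Plane => f (√l • x))
    (Continuous.aestronglyMeasurable (by fun_prop))
  rw [hχ.map_containingNucleus hl.le hK hn,
    integral_withDensity_eq_integral_toReal_smul (by fun_prop)
      (ae_of_all _ fun _ => ENNReal.ofReal_lt_top)] at h1
  rw [← h1]
  have h2 := Measure.integral_comp_smul (volume : Measure Plane)
    (fun z => f z * rescaledWeight K l z) (√l)
  rw [finrank_euclideanSpace_fin, Real.sq_sqrt hl.le, abs_of_pos (inv_pos.2 hl), smul_eq_mul] at h2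
  have h3 : ∫ z, f z * rescaledWeight K l z =
      l * ∫ x : Plane, f (√l • x) * rescaledWeight K l (√l • x) := by
    rw [h2, ← mul_assoc, mul_inv_cancel₀ hl.ne', one_mul]
  rw [h3, ← integral_const_mul, ← integral_const_mul]
  refine integral_congr_ae (ae_of_all _ fun x => ?_)
  dsimp only
  rw [ENNReal.toReal_ofReal (by positivity), rescaledWeight, smul_smul,
    inv_mul_cancel₀ hsl.ne', one_smul, smul_eq_mul]
  have : Real.exp (-(l * (2 * flowerIntegral K x))) = Real.exp (-(l * (2 * flowerIntegral K 0))) *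
      Real.exp (-(l * (2 * (flowerIntegral K x - flowerIntegral K 0)))) := by
    rw [← Real.exp_add]; ring_nf
  rw [this]; ring

lemma IsPoissonProcess.prob_cellEvent (hχ : IsPoissonProcess P χ l) (hl : 0 < l)
    (hK : IsCompact K) (hn : K.Nonempty) :
    P.real (cellEvent K χ) =
      Real.exp (-(l * (2 * flowerIntegral K 0))) * ∫ z, rescaledWeight K l z := by
  have := hχ.setIntegral_rescaled hl hK hn (continuous_const (y := (1 : ℝ)))
  simpa using this

lemma IsPoissonProcess.prob_cellEvent_pos (hχ : IsPoissonProcess P χ l) (hl : 0 < l)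
    (hK : IsCompact K) (hn : K.Nonempty) (hc : Convex ℝ K) (h0 : steinerPoint K = 0) :
    0 < P (cellEvent K χ) := by
  have h1 : 0 < ∫ z, rescaledWeight K l z :=
    integral_exp_pos (integrable_rescaledWeight hK hn hc h0 hl)
  have h2 : 0 < P.real (cellEvent K χ) := by
    rw [hχ.prob_cellEvent hl hK hn]
    positivity
  exact (ENNReal.toReal_pos_iff.1 h2).1

lemma IsPoissonProcess.integral_cond_rescaled (hχ : IsPoissonProcess P χ l) (hl : 0 < l)
    (hK : IsCompact K) (hn : K.Nonempty) {f : Plane → ℝ} (hf : Continuous f) :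
    ∫ ω, f (√l • containingNucleus K (χ ω)) ∂P[|cellEvent K χ] =
      (∫ z, f z * rescaledWeight K l z) / ∫ z, rescaledWeight K l z := by
  rw [ProbabilityTheory.cond, integral_smul_measure, hχ.setIntegral_rescaled hl hK hn hf,
    ENNReal.toReal_inv, ← measureReal_def, hχ.prob_cellEvent hl hK hn, smul_eq_mul, ← div_eq_inv_mul,
    mul_div_mul_left _ _ (Real.exp_pos _).ne']

lemma IsPoissonProcess.aemeasurable_rescaled (hχ : IsPoissonProcess P χ l) (hl : 0 < l)
    (hK : IsCompact K) (hn : K.Nonempty) :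
    AEMeasurable (fun ω => √l • containingNucleus K (χ ω)) P[|cellEvent K χ] := by
  have h := hχ.aemeasurable_containingNucleus hl.le hK hn
  exact (h.smul_measure (P (cellEvent K χ))⁻¹).const_smul (√l)

end conditional

/-- Each intensity may have its own probability space. The existential over `IsProbabilityMeasure`
supplies the instances that convergence in distribution requires, and the limit is the identity map
under the Gaussian law. -/
theorem mainTheorem5 (K : ConvexBody Plane) :
    -- convergence in distribution of the rescaled nucleus, conditionally on the event
    ((K : Set Plane).Nontrivial → steinerPoint (K : Set Plane) = 0 →
      ∀ (Ω : Set.Ioi (0 : ℝ) → Type*) [∀ l, MeasurableSpace (Ω l)]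
        (P : (l : Set.Ioi (0 : ℝ)) → Measure (Ω l)) [∀ l, IsProbabilityMeasure (P l)]
        (χ : (l : Set.Ioi (0 : ℝ)) → Ω l → Set Plane),
        (∀ l, IsPoissonProcess (P l) (χ l) l) →
        -- the event has positive probability, and on it the nucleus is almost surely unique
        (∀ l, MeasurableSet (cellEvent (K : Set Plane) (χ l)) ∧
          0 < P l (cellEvent (K : Set Plane) (χ l)) ∧
          ∀ᵐ ω ∂(P l), ω ∈ cellEvent (K : Set Plane) (χ l) →
            ∃! x, IsContainingNucleus (K : Set Plane) (χ l ω) x) ∧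
        ∃ _ : ∀ l, IsProbabilityMeasure ((P l)[|cellEvent (K : Set Plane) (χ l)]),
          TendstoInDistribution
            (fun (l : Set.Ioi (0 : ℝ)) (ω : Ω l) =>
              Real.sqrt l • containingNucleus (K : Set Plane) (χ l ω))
            atTop (id : Plane → Plane)
            (fun l => (P l)[|cellEvent (K : Set Plane) (χ l)])
            (multivariateGaussian 0 ((4 * Real.pi)⁻¹ • (1 : Matrix (Fin 2) (Fin 2) ℝ)))) ∧
    -- the Steiner point is the unique minimizer of the area of the flower
    (∀ x : Plane, x ≠ steinerPoint (K : Set Plane) →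
      volume (voronoiFlower (steinerPoint (K : Set Plane)) (K : Set Plane)) <
        volume (voronoiFlower x (K : Set Plane))) := by
  have hK := K.isCompact
  have hn := K.nonempty
  have hc := K.convex
  refine ⟨fun hnt h0 Ω _ P _ χ hχ => ?_,
    fun x hx => volume_voronoiFlower_steinerPoint_lt hK hn hc hx⟩
  have hpos : ∀ l, 0 < P l (cellEvent (K : Set Plane) (χ l)) := fun l =>
    (hχ l).prob_cellEvent_pos l.2 hK hn hc h0
  refine ⟨fun l => ⟨(hχ l).measurableSet_cellEvent hK, hpos l, ?_⟩,
    fun l => cond_isProbabilityMeasure (hpos l).ne', ?_⟩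
  · filter_upwards [(hχ l).ae_nucleus_unique (K := K) (le_of_lt l.2) hn] with ω hω hE
    obtain ⟨x, hx⟩ := hE
    exact ⟨x, hx, fun x' hx' => hω x' x hx' hx⟩
  · have hm := fun l : Set.Ioi (0 : ℝ) => (hχ l).aemeasurable_rescaled l.2 hK hn
    have hprob := fun l => cond_isProbabilityMeasure (hpos l).ne'
    refine ⟨hm, aemeasurable_id, ?_⟩
    refine ProbabilityMeasure.tendsto_iff_forall_integral_tendsto.2 fun f => ?_
    have hlim : Tendsto (fun l : ℝ => (∫ z, f z * rescaledWeight (K : Set Plane) l z) /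
        ∫ z, rescaledWeight (K : Set Plane) l z) atTop
        (𝓝 ((∫ z, f z * Real.exp (-(2 * Real.pi * ‖z‖ ^ 2))) / (1 / 2))) := by
      refine (tendsto_integral_rescaledWeight hK hnt hc h0 f).div ?_ (by norm_num)
      -- The test function 1 gives the limit of the normalization, π/(2π) = 1/2.
      have h := tendsto_integral_rescaledWeight hK hnt hc h0
        (BoundedContinuousFunction.const Plane (1 : ℝ))
      simp only [BoundedContinuousFunction.const_apply, one_mul] at h
      rw [integral_exp_neg_mul_norm_sq (by positivity)] at h
      convert h using 2
      have := Real.pi_ne_zero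
      field_simp
    have hgauss : ∫ z, f z ∂(multivariateGaussian (0 : Plane)
        ((4 * Real.pi)⁻¹ • (1 : Matrix (Fin 2) (Fin 2) ℝ))) =
        (∫ z, f z * Real.exp (-(2 * Real.pi * ‖z‖ ^ 2))) / (1 / 2) := by
      rw [multivariateGaussian_eq_withDensity,
        integral_withDensity_eq_integral_toReal_smul (by fun_prop)
          (ae_of_all _ fun _ => ENNReal.ofReal_lt_top), div_eq_mul_inv, ← integral_mul_const]
      refine integral_congr_ae (ae_of_all _ fun z => ?_)
      dsimp only
      rw [ENNReal.toReal_ofReal (by positivity), smul_eq_mul]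
      ring
    simp only [ProbabilityMeasure.coe_mk, Measure.map_id]
    rw [hgauss]
    refine (tendsto_comp_val_Ioi_atTop.2 hlim).congr fun l => ?_
    rw [integral_map (hm l) f.continuous.aestronglyMeasurable,
      (hχ l).integral_cond_rescaled l.2 hK hn f.continuous]
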